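/- Let $(X,\mu)$ be a $\sigma$-finite measure space, $V$ a separable complex Hilbert space, $A$ a (possibly unbounded) self-adjoint operator on $\mathcal H=L^2(X,\mu;V)$, with no positivity or Markov assumption, and $\tau$ the trace. For a bounded positive operator $P$ on $\mathcal H$ let $\nu_P$ be the measure $\nu_P(\Omega)=\tau(P^{1/2}\chi_\Omega P^{1/2})$ on $X$ and $D\nu_P=d\nu_P/d\mu$ its density. With the spectral projections $\Pi_\lambda=\Pi_{]-\infty,\lambda[}(A)$ put $$F_A(\lambda)=\operatorname*{ess\,sup}_{x\in X} D\nu_{\Pi_\lambda}(x)\in[0,+\infty],\qquad \lambda\in\mathbb R .$$ Let $\rho$ be a state (a positive trace class operator on $\mathcal H$) with $\tau(\rho)=1$ such that $\mathcal E_A^+(\rho)=\tau(\rho^{1/2}\max(A,0)\rho^{1/2})$ is finite, let $$\mathcal E(\rho)=\tau(\rho A)=\mathcal E_A^+(\rho)-\tau(\rho^{1/2}\max(-A,0)\rho^{1/2})\in[-\infty,+\infty[$$ be its energy, and let $$S_\mu(\rho)=-\int_X\ln\Bigl(\frac{D\nu_\rho(x)}{\|\rho\|_\infty}\Bigr)\,d\nu_\rho(x)+3\,\tau(\rho),$$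 where $\|\rho\|_\infty$ is the operator norm, and $S_\mu(\rho)=-\infty$ by convention if the positive part of $\ln(D\nu_\rho/\|\rho\|_\infty)$ is not $\nu_\rho$-integrable. Let $(\ln F_A)^c$ be the concave hull of $\ln F_A$, i.e. the infimum of all concave functions $\mathbb R\to\mathbb R$ that are $\ge\ln F_A$ (identically $+\infty$ if there are none), extended to $-\infty$ by its limit there, and for $t\in\mathbb R$ let $$m(t)=\sup_{\lambda\in\mathbb R}\bigl(\ln F_A(\lambda)-t\lambda\bigr),$$ minus the concave Legendre transform of $\ln F_A$. Then $$-S_\mu(\rho)\le(\ln F_A)^c(\mathcal E(\rho)),$$ and if the right-hand side is $<+\infty$, then the positive part of $\ln(D\nu_\rho/\|\rho\|_\infty)$ is $\nu_\rho$-integrable. Equivalently, the parametric log-Sobolev inequalities $$-S_\mu(\rho)\le m(t)\,\tau(\rho)+t\,\mathcal E(\rho)$$ hold for every $t\in\mathbb R$ with $m(t)<+\infty$ (with $0\cdot(-\infty)=0$). The equivalence is that, for all $s\in[-\infty,+\infty]$ and $e\in[-\infty,+\infty[$, one has $s\le(\ln F_A)^c(e)$ if and only if $s\le m(t)+t\,e$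 for every $t\in\mathbb R$ with $m(t)<+\infty$. -/

import Mathlib

open MeasureTheory
open scoped ENNReal InnerProductSpace

noncomputable section

namespace EntropyEnergy

section Hilbert

variable {H : Type*} [NormedAddCommGroup H] [InnerProductSpace ℂ H] [CompleteSpace H]

/-- A projection-valued measure on the Borel sets of `ℝ`, acting on `H`
(`proj B` carries no information when `B` is not a Borel set). -/
structure ProjMeasure (H : Type*) [NormedAddCommGroup H] [InnerProductSpace ℂ H]
    [CompleteSpace H] where
  proj : Set ℝ → (H →L[ℂ] H)
  isStarProjection : ∀ B : Set ℝ, MeasurableSet B → IsStarProjection (proj B)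
  proj_univ : proj Set.univ = 1
  hasSum_iUnion : ∀ B : ℕ → Set ℝ, (∀ n, MeasurableSet (B n)) →
    Pairwise (fun m n => Disjoint (B m) (B n)) →
    ∀ x : H, HasSum (fun n => proj (B n) x) (proj (⋃ n, B n) x)

namespace ProjMeasure

theorem proj_empty (E : ProjMeasure H) : E.proj ∅ = 0 := by
  ext x
  have h := E.hasSum_iUnion (fun _ => ∅) (fun _ => MeasurableSet.empty)
    (fun _ _ _ => Set.disjoint_empty _) x
  have h2 := h.summable.tendsto_atTop_zero
  simpa using tendsto_nhds_unique tendsto_const_nhds h2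

theorem re_inner_nonneg (E : ProjMeasure H) {B : Set ℝ} (hB : MeasurableSet B) (x : H) :
    0 ≤ (⟪E.proj B x, x⟫_ℂ).re := by
  have h := E.isStarProjection B hB
  have h1 : E.proj B x = E.proj B (E.proj B x) := by
    conv_lhs => rw [← h.isIdempotentElem.eq]
    rfl
  have h2 : ⟪E.proj B (E.proj B x), x⟫_ℂ = ⟪E.proj B x, E.proj B x⟫_ℂ := by
    have := (ContinuousLinearMap.isSelfAdjoint_iff_isSymmetric.mp h.isSelfAdjoint)
      (E.proj B x) x
    simpa using this
  rw [h1, h2]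
  exact inner_self_nonneg (𝕜 := ℂ)

/-- The Borel measure `B ↦ ⟨E(B) x, x⟩`. -/
def dist (E : ProjMeasure H) (x : H) : Measure ℝ :=
  Measure.ofMeasurable (fun B _ => ENNReal.ofReal (⟪E.proj B x, x⟫_ℂ).re)
    (by simp [E.proj_empty])
    (by
      intro B hB hd
      have h := E.hasSum_iUnion B hB (fun m n hmn => hd hmn) x
      have h1 : HasSum (fun n => (⟪E.proj (B n) x, x⟫_ℂ).re)
          (⟪E.proj (⋃ n, B n) x, x⟫_ℂ).re := by
        have h2 := h.mapL (innerSL ℂ x)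
        have h3 := h2.mapL Complex.reCLM
        have e : ∀ y : H, (⟪y, x⟫_ℂ).re = (⟪x, y⟫_ℂ).re := fun y => inner_re_symm (𝕜 := ℂ) y x
        simpa [e] using h3
      rw [← h1.tsum_eq]
      exact ENNReal.ofReal_tsum_of_nonneg (fun n => E.re_inner_nonneg (hB n) x) h1.summable)

theorem dist_apply (E : ProjMeasure H) (x : H) {B : Set ℝ} (hB : MeasurableSet B) :
    E.dist x B = ENNReal.ofReal (⟪E.proj B x, x⟫_ℂ).re :=
  Measure.ofMeasurable_apply B hB

open Classical in
/-- The projection-valued measure concentrated at `0`. -/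
instance : Inhabited (ProjMeasure H) where
  default :=
    { proj := fun B => if (0 : ℝ) ∈ B then 1 else 0
      isStarProjection := by
        intro B _
        by_cases h : (0 : ℝ) ∈ B
        · simp [h]
        · simp [h]
      proj_univ := by simp
      hasSum_iUnion := by
        intro B _ hd x
        by_cases h : ∃ n, (0 : ℝ) ∈ B n
        · obtain ⟨n, hn⟩ := h
          have h1 : (0 : ℝ) ∈ ⋃ n, B n := Set.mem_iUnion.2 ⟨n, hn⟩
          simp only [h1, if_true]
          have h2 := hasSum_single (f := fun m =>
            (if (0 : ℝ) ∈ B m then (1 : H →L[ℂ] H) else 0) x) n (by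
              intro m hm
              have : (0 : ℝ) ∉ B m := fun h0 => Set.disjoint_left.1 (hd hm) h0 hn
              simp [this])
          simpa [hn] using h2
        · have h1 : (0 : ℝ) ∉ ⋃ n, B n := by simpa using h
          have h2 : ∀ n, (0 : ℝ) ∉ B n := by simpa using h
          simp [h2, hasSum_zero] }

end ProjMeasure

/-- `A = ∫ λ dE(λ)`: the domain of `A` is `{x | ∫ λ² d⟨E x, x⟩ < ∞}`, and
`⟨A x, x⟩ = ∫ λ d⟨E x, x⟩` on it. -/
structure IsSpectralMeasure (A : H →ₗ.[ℂ] H) (E : ProjMeasure H) : Prop where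
  mem_domain : ∀ x : H, x ∈ A.domain ↔ ∫⁻ l : ℝ, ENNReal.ofReal (l ^ 2) ∂(E.dist x) < ⊤
  inner_apply : ∀ x : A.domain, ⟪A x, (x : H)⟫_ℂ = ((∫ l : ℝ, l ∂(E.dist (x : H)) : ℝ) : ℂ)

open Classical in
/-- The spectral measure of `A`: the projection-valued measure `E` with `A = ∫ λ dE(λ)`
(by the spectral theorem it exists and is unique when `A` is self-adjoint). -/
def spectralMeasure (A : H →ₗ.[ℂ] H) : ProjMeasure H :=
  if h : ∃ E : ProjMeasure H, IsSpectralMeasure A E then h.choose else default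

/-- The spectral projection of `A` on the open half-line `]-∞, l[`. -/
def specProj (A : H →ₗ.[ℂ] H) (l : ℝ) : H →L[ℂ] H := (spectralMeasure A).proj (Set.Iio l)

variable (H) in
/-- The index set of a Hilbert basis of `H`. -/
def basisSet : Set H := (exists_hilbertBasis ℂ H).choose

variable (H) in
/-- A Hilbert basis of `H`. -/
def hilbBasis : HilbertBasis (basisSet H) ℂ H := (exists_hilbertBasis ℂ H).choose_spec.choose

/-- The trace, in `[0, ∞]`, of a bounded positive operator. -/
def trace (T : H →L[ℂ] H) : ℝ≥0∞ :=
  ∑' i, ENNReal.ofReal (⟪T (hilbBasis H i), hilbBasis H i⟫_ℂ).re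

/-- The positive square root of a bounded positive operator. -/
def sqrtOp (T : H →L[ℂ] H) : H →L[ℂ] H := CFC.sqrt T

/-- `τ(ρ^{1/2} f(A) ρ^{1/2})` in `[0, ∞]`, for Borel `f ≥ 0`: the trace of the quadratic form
`x ↦ ⟨f(A) ρ^{1/2} x, ρ^{1/2} x⟩`, where `⟨f(A) y, y⟩ = ∫ f(λ) d⟨E(λ) y, y⟩`. -/
def energyOf (A : H →ₗ.[ℂ] H) (f : ℝ → ℝ≥0∞) (ρ : H →L[ℂ] H) : ℝ≥0∞ :=
  ∑' i, ∫⁻ l : ℝ, f l ∂((spectralMeasure A).dist (sqrtOp ρ (hilbBasis H i)))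

/-- `τ(ρ^{1/2} max(A, 0) ρ^{1/2})`. -/
def energyPos (A : H →ₗ.[ℂ] H) (ρ : H →L[ℂ] H) : ℝ≥0∞ :=
  energyOf A (fun l => ENNReal.ofReal l) ρ

/-- `τ(ρ^{1/2} max(-A, 0) ρ^{1/2})`. -/
def energyNeg (A : H →ₗ.[ℂ] H) (ρ : H →L[ℂ] H) : ℝ≥0∞ :=
  energyOf A (fun l => ENNReal.ofReal (-l)) ρ

/-- The energy `τ(ρ A)`, in `[-∞, ∞[` when `energyPos A ρ` is finite. -/
def energy (A : H →ₗ.[ℂ] H) (ρ : H →L[ℂ] H) : EReal :=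
  (energyPos A ρ : EReal) - (energyNeg A ρ : EReal)

end Hilbert

section Density

variable {X : Type*} [MeasurableSpace X] {μ : Measure X}
  {V : Type*} [NormedAddCommGroup V] [InnerProductSpace ℂ V] [CompleteSpace V]

/-- The measure `Ω ↦ τ(P^{1/2} χ_Ω P^{1/2}) = ∑ᵢ ∫_Ω ‖(P^{1/2} eᵢ)(x)‖² dμ(x)` of a bounded
positive operator `P` on `L²(X, V)`. -/
def densMeasure (P : Lp V 2 μ →L[ℂ] Lp V 2 μ) : Measure X :=
  Measure.sum fun i => μ.withDensity fun x =>
    ‖(sqrtOp P (hilbBasis (Lp V 2 μ) i) : Lp V 2 μ) x‖ₑ ^ 2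

/-- The density function of `P`: the density of `densMeasure P` with respect to `μ`. -/
def dens (P : Lp V 2 μ →L[ℂ] Lp V 2 μ) : X → ℝ≥0∞ := (densMeasure P).rnDeriv μ

/-- `F_A(l)`, the essential supremum over `x` of the spectral density function `F_{A,x}(l)`. -/
def specDensity (A : Lp V 2 μ →ₗ.[ℂ] Lp V 2 μ) (l : ℝ) : ℝ≥0∞ :=
  essSup (dens (specProj A l)) μ

/-- `∫ max(ln(Dν_ρ / ‖ρ‖), 0) dν_ρ`. -/
def logDensPos (ρ : Lp V 2 μ →L[ℂ] Lp V 2 μ) : ℝ≥0∞ :=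
  ∫⁻ x, (ENNReal.log (dens ρ x / ‖ρ‖ₑ)).toENNReal ∂(densMeasure ρ)

/-- `∫ max(-ln(Dν_ρ / ‖ρ‖), 0) dν_ρ`. -/
def logDensNeg (ρ : Lp V 2 μ →L[ℂ] Lp V 2 μ) : ℝ≥0∞ :=
  ∫⁻ x, (-ENNReal.log (dens ρ x / ‖ρ‖ₑ)).toENNReal ∂(densMeasure ρ)

/-- `S_μ(ρ) = -∫ ln(Dν_ρ / ‖ρ‖) dν_ρ + 3 τ(ρ)`, equal to `-∞` as soon as the positive part
of `ln(Dν_ρ / ‖ρ‖)` has infinite integral. -/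
def spatialEntropy (ρ : Lp V 2 μ →L[ℂ] Lp V 2 μ) : EReal :=
  ((logDensNeg ρ : EReal) - (logDensPos ρ : EReal)) + 3 * (trace ρ : EReal)

end Density

/-- The concave hull of `f`: the infimum of the concave functions `ℝ → ℝ` lying above `f`
(`+∞` if there are none). -/
def concaveHull (f : ℝ → EReal) (e : ℝ) : EReal :=
  ⨅ (g : ℝ → ℝ) (_ : ConcaveOn ℝ Set.univ g) (_ : ∀ x, f x ≤ (g x : EReal)), (g e : EReal)

/-- The extension of a nondecreasing `h : ℝ → [-∞, ∞]` to `[-∞, ∞[`, its value at `-∞` being its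
limit (that is, its infimum) there. -/
def extendBot (h : ℝ → EReal) (e : EReal) : EReal :=
  if e = ⊥ then ⨅ x : ℝ, h x else h e.toReal

/-- Minus the concave Legendre transform of `f`: `sup_x (f x - t x)`. -/
def negLegendre (f : ℝ → EReal) (t : ℝ) : EReal :=
  ⨆ x : ℝ, f x - ((t * x : ℝ) : EReal)

end EntropyEnergy

end

/-! Split the state at an energy level `l`: each `ρ^{1/2} eᵢ` is the sum of its images under the
spectral projections of `]-∞, l[` and `[l, ∞[`. The low part has density at most `‖ρ‖ F_A(l)`
(`sum_withDensity_specProj_le`), so Minkowski's inequality in `ℓ²` gives, for the density `D` of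
`ρ`, `√D ≤ √(‖ρ‖ F_A(l)) + √D_l` almost everywhere, with `D_l` the density of the high part
(`dens_rpow_le`).

Suppose `F_A(l) ≤ exp (c + t (l - a))` for `l ≥ a`, with `t > 0`, and put `u = D / ‖ρ‖`. Then `D_l ≥
‖ρ‖ (√u - e^{(c + s)/2})₊²` at `s = t (l - a)`. Integrating over `s ≥ 0`, the right side yields at
least `D (ln u - c - 3)`, which is the origin of the constant 3. The left side, integrated also over
`X`, yields by layer cake at most `t` times the energy counted above `a`. A Riemann sum of step `d`
in `s` replaces this integral (`lintegral_logDens_sub_le`), and `d → 0` gives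
`neg_spatialEntropy_le_energyOf`.

Letting `a = -n → -∞` recovers the full energy (`neg_spatialEntropy_le_of_pos`); slope zero is a
limit of small positive slopes; a negative slope forces `F_A = 0` by monotonicity. The concave hull
form follows because a concave function lies below its supporting lines, so the hull is the infimum
of the affine majorants (`le_extendBot_concaveHull_iff`). -/

noncomputable section

namespace EntropyEnergy

/-! ### Densities, Minkowski's inequality and indicator operators on `L²`. -/

section MeasureLemmas

variable {X : Type*} [MeasurableSpace X] {μ : Measure X}

/-- The Radon-Nikodym theorem for an arbitrary measure that is absolutely continuous with respect
to a `σ`-finite measure. -/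
theorem haveLebesgueDecomposition_of_absolutelyContinuous [SigmaFinite μ] {ν : Measure X}
    (h : ν ≪ μ) : ν.HaveLebesgueDecomposition μ := by
  -- `ν` need not be `σ`-finite: off its `σ`-finite part `s` it is `∞ • μ`, so the density there is
  -- the constant `∞`.
  set s := ν.sigmaFiniteSetWRT μ with hs
  have hsm : MeasurableSet s := measurableSet_sigmaFiniteSetWRT
  have h1 : μ.withDensity ((ν.restrict s).rnDeriv μ) = ν.restrict s :=
    Measure.withDensity_rnDeriv_eq _ _ (Measure.restrict_le_self.absolutelyContinuous.trans h)
  have h2 : μ.withDensity (sᶜ.indicator fun _ => ∞) = ν.restrict sᶜ := by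
    rw [withDensity_indicator hsm.compl, withDensity_const, hs, restrict_compl_sigmaFiniteSetWRT h]
  refine ⟨⟨(0, (ν.restrict s).rnDeriv μ + sᶜ.indicator fun _ => ∞), ?_, ?_, ?_⟩⟩
  · exact (Measure.measurable_rnDeriv _ _).add (measurable_const.indicator hsm.compl)
  · exact Measure.MutuallySingular.zero_left
  · rw [zero_add, withDensity_add_left (Measure.measurable_rnDeriv _ _), h1, h2,
      Measure.restrict_add_restrict_compl hsm]

theorem withDensity_le_iff_ae_le [SigmaFinite μ] {f g : X → ℝ≥0∞} (hf : Measurable f) :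
    μ.withDensity f ≤ μ.withDensity g ↔ f ≤ᵐ[μ] g := by
  refine ⟨fun h => ?_, withDensity_mono⟩
  refine ae_le_of_forall_setLIntegral_le_of_sigmaFinite hf fun s hs _ => ?_
  rw [← withDensity_apply _ hs, ← withDensity_apply _ hs]
  exact h s

/-- Minkowski's inequality for countable families of extended nonnegative reals. -/
theorem tsum_add_sq_rpow_le {ι : Type*} [Countable ι] (f g : ι → ℝ≥0∞) :
    (∑' i, (f i + g i) ^ 2) ^ (1 / 2 : ℝ) ≤
      (∑' i, f i ^ 2) ^ (1 / 2 : ℝ) + (∑' i, g i ^ 2) ^ (1 / 2 : ℝ) := by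
  let _ : MeasurableSpace ι := ⊤
  have h := ENNReal.lintegral_Lp_add_le (μ := Measure.count) (p := 2)
    (measurable_from_top (f := f)).aemeasurable (measurable_from_top (f := g)).aemeasurable
    one_le_two
  simpa [lintegral_count] using h

variable {V : Type*} [NormedAddCommGroup V]

theorem lintegral_enorm_sq_coeFn (g : Lp V 2 μ) : ∫⁻ x, ‖g x‖ₑ ^ 2 ∂μ = ‖g‖ₑ ^ 2 := by
  rw [Lp.enorm_def, eLpNorm_eq_lintegral_rpow_enorm_toReal two_ne_zero ENNReal.ofNat_ne_top]
  rw [← ENNReal.rpow_natCast, ← ENNReal.rpow_mul]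
  simp

theorem measurable_enorm_sq_coeFn (g : Lp V 2 μ) : Measurable fun x => ‖g x‖ₑ ^ 2 :=
  (Lp.stronglyMeasurable g).enorm.pow_const 2

variable [InnerProductSpace ℂ V] [CompleteSpace V]

/-- Multiplication by the indicator of a measurable set, as a bounded operator on `L²`. -/
def indicatorOp (μ : Measure X) (V : Type*) [NormedAddCommGroup V] [InnerProductSpace ℂ V]
    [CompleteSpace V] {s : Set X} (hs : MeasurableSet s) : Lp V 2 μ →L[ℂ] Lp V 2 μ :=
  LinearMap.mkContinuous
    { toFun := fun f => ((Lp.memLp f).indicator hs).toLp (s.indicator f)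
      map_add' := fun f g => by
        rw [← MemLp.toLp_add]
        refine (MemLp.toLp_eq_toLp_iff _ _).2 ?_
        filter_upwards [Lp.coeFn_add f g] with x hx
        by_cases h : x ∈ s
        · simpa [h] using hx
        · simp [h]
      map_smul' := fun c f => by
        rw [RingHom.id_apply, ← MemLp.toLp_const_smul]
        refine (MemLp.toLp_eq_toLp_iff _ _).2 ?_
        filter_upwards [Lp.coeFn_smul c f] with x hx
        by_cases h : x ∈ s
        · simpa [h] using hx
        · simp [h] } 1 fun f => by
    rw [one_mul]
    refine Lp.norm_le_norm_of_ae_le ?_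
    filter_upwards [((Lp.memLp f).indicator hs).coeFn_toLp] with x hx
    simp only [LinearMap.coe_mk, AddHom.coe_mk, hx]
    exact norm_indicator_le_norm_self _ _

theorem coeFn_indicatorOp {s : Set X} (hs : MeasurableSet s) (f : Lp V 2 μ) :
    indicatorOp μ V hs f =ᵐ[μ] s.indicator f :=
  ((Lp.memLp f).indicator hs).coeFn_toLp

theorem isSelfAdjoint_indicatorOp {s : Set X} (hs : MeasurableSet s) :
    IsSelfAdjoint (indicatorOp μ V hs) := by
  rw [ContinuousLinearMap.isSelfAdjoint_iff_isSymmetric]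
  intro f g
  simp only [ContinuousLinearMap.coe_coe, L2.inner_def]
  refine integral_congr_ae ?_
  filter_upwards [coeFn_indicatorOp hs f, coeFn_indicatorOp hs g] with x hf hg
  rw [hf, hg]
  by_cases h : x ∈ s <;> simp [h]

theorem enorm_indicatorOp_sq {s : Set X} (hs : MeasurableSet s) (f : Lp V 2 μ) :
    ‖indicatorOp μ V hs f‖ₑ ^ 2 = ∫⁻ x in s, ‖f x‖ₑ ^ 2 ∂μ := by
  rw [← lintegral_enorm_sq_coeFn, ← lintegral_indicator hs]
  refine lintegral_congr_ae ?_
  filter_upwards [coeFn_indicatorOp hs f] with x hx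
  rw [hx]
  by_cases h : x ∈ s <;> simp [h]

end MeasureLemmas

/-! ### The scalar inequality that produces the constant 3. -/

section RealLemmas

/-- The antiderivative of `(1 - exp (-r / 2)) ^ 2` on the half-line `r ≥ 0` that vanishes at `0`,
extended by zero to negative reals. -/
def expGap (r : ℝ) : ℝ :=
  max r 0 - 4 * (1 - Real.exp (-(max r 0) / 2)) + (1 - Real.exp (-(max r 0)))

theorem expGap_of_nonpos {r : ℝ} (hr : r ≤ 0) : expGap r = 0 := by
  simp [expGap, max_eq_right hr]

/-- With `q = exp (-s / 2)` in `]0, 1]`, the gap is `s - 3 + 4 q - q²`, and `4 q ≥ q²`. -/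
theorem sub_three_le_expGap (r : ℝ) : r - 3 ≤ expGap r := by
  unfold expGap
  have h1 : r ≤ max r 0 := le_max_left _ _
  set s := max r 0
  have h2 : Real.exp (-s) = Real.exp (-s / 2) ^ 2 := by
    rw [← Real.exp_nat_mul]; congr 1; push_cast; ring
  have h3 : Real.exp (-s / 2) ≤ 1 := Real.exp_le_one_iff.2 (by
    have : 0 ≤ s := le_max_right _ _
    linarith)
  have h4 := Real.exp_pos (-s / 2)
  rw [h2]
  nlinarith

/-- The derivative `(1 - exp (-r / 2))²` increases on `r ≥ 0`, so the mean value inequality bounds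
it by its value at the right endpoint. -/
theorem expGap_sub_le_aux {x y : ℝ} (hy : 0 ≤ y) (hxy : y ≤ x) :
    (x - 4 * (1 - Real.exp (-x / 2)) + (1 - Real.exp (-x))) -
      (y - 4 * (1 - Real.exp (-y / 2)) + (1 - Real.exp (-y))) ≤
      (1 - Real.exp (-x / 2)) ^ 2 * (x - y) := by
  have hd : ∀ r : ℝ, HasDerivAt
      (fun r : ℝ => r - 4 * (1 - Real.exp (-r / 2)) + (1 - Real.exp (-r)))
      ((1 - Real.exp (-r / 2)) ^ 2) r := by
    intro r
    have e1 : HasDerivAt (fun r : ℝ => Real.exp (-r / 2)) (Real.exp (-r / 2) * (-1 / 2)) r :=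
      ((hasDerivAt_id r).neg.div_const 2).exp
    have e2 : HasDerivAt (fun r : ℝ => Real.exp (-r)) (Real.exp (-r) * (-1)) r :=
      (hasDerivAt_id r).neg.exp
    refine (((hasDerivAt_id r).sub ((e1.const_sub 1).const_mul 4)).add
      (e2.const_sub 1)).congr_deriv ?_
    have h2 : Real.exp (-r) = Real.exp (-r / 2) ^ 2 := by
      rw [← Real.exp_nat_mul]; congr 1; push_cast; ring
    rw [h2]
    ring
  refine Convex.image_sub_le_mul_sub_of_deriv_le (convex_Icc y x)
    (fun r _ => (hd r).continuousAt.continuousWithinAt)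
    (fun r _ => (hd r).differentiableAt.differentiableWithinAt) ?_ y ⟨le_rfl, hxy⟩ x
    ⟨hxy, le_rfl⟩ hxy
  intro r hr
  rw [interior_Icc] at hr
  rw [(hd r).deriv]
  have h1 : Real.exp (-x / 2) ≤ Real.exp (-r / 2) := Real.exp_le_exp.2 (by linarith [hr.2])
  have h2 : Real.exp (-r / 2) ≤ 1 := Real.exp_le_one_iff.2 (by linarith [hr.1])
  exact pow_le_pow_left₀ (by linarith) (by linarith) 2

theorem expGap_sub_le {r d : ℝ} (hd : 0 ≤ d) :
    expGap r - expGap (r - d) ≤ d * (max (1 - Real.exp (-r / 2)) 0) ^ 2 := by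
  rcases le_total r 0 with hr | hr
  · rw [expGap_of_nonpos hr, expGap_of_nonpos (by linarith)]
    simp only [sub_zero]
    positivity
  · have h1 : Real.exp (-r / 2) ≤ 1 := Real.exp_le_one_iff.2 (by linarith)
    have h2 : max (r - d) 0 ≤ r := max_le (by linarith) hr
    have h3 := expGap_sub_le_aux (le_max_right (r - d) 0) h2
    have h4 : r - d ≤ max (r - d) 0 := le_max_left _ _
    rw [max_eq_left (by linarith : (0 : ℝ) ≤ 1 - Real.exp (-r / 2))]
    unfold expGap
    rw [max_eq_left hr]
    nlinarith [sq_nonneg (1 - Real.exp (-r / 2))]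

/-- The sum dominates a telescoping sum of `expGap`. Sampling starts at `k + 1`, to match the lower
Riemann sum used for the energy; this costs the extra `d`. -/
theorem exists_sub_le_sum_sq {d : ℝ} (hd : 0 < d) (s : ℝ) :
    ∃ N : ℕ, s - d - 3 ≤ ∑ k ∈ Finset.range N,
      d * (max (1 - Real.exp (-(s - (k + 1) * d) / 2)) 0) ^ 2 := by
  obtain ⟨N, hN⟩ := exists_nat_gt (s / d)
  rw [div_lt_iff₀ hd] at hN
  refine ⟨N, ?_⟩
  have h := Finset.sum_range_sub' (fun k : ℕ => expGap (s - (k + 1) * d)) N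
  have h0 : expGap (s - ((N : ℝ) + 1) * d) = 0 := expGap_of_nonpos (by linarith)
  calc s - d - 3 ≤ expGap (s - d) := sub_three_le_expGap _
    _ = ∑ k ∈ Finset.range N,
        (expGap (s - ((k : ℝ) + 1) * d) - expGap (s - (((k + 1 : ℕ) : ℝ) + 1) * d)) := by
      rw [h, h0]; simp
    _ ≤ _ := Finset.sum_le_sum fun k _ => by
      have e : s - (((k + 1 : ℕ) : ℝ) + 1) * d = s - (k + 1) * d - d := by push_cast; ring
      rw [e]
      exact expGap_sub_le hd.le

/-- The discretised form of the integral of `(√u - exp ((c + s) / 2))₊ ^ 2` over `s ≥ 0`. -/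
theorem exists_mul_log_sub_le_sum_sq {d u : ℝ} (hd : 0 < d) (hu : 0 < u) (c : ℝ) :
    ∃ N : ℕ, u * (Real.log u - c - d - 3) ≤ ∑ k ∈ Finset.range N,
      d * (max (√u - √(Real.exp (c + (k + 1) * d))) 0) ^ 2 := by
  obtain ⟨N, hN⟩ := exists_sub_le_sum_sq hd (Real.log u - c)
  refine ⟨N, (mul_le_mul_of_nonneg_left hN hu.le).trans_eq ?_⟩
  rw [Finset.mul_sum]
  refine Finset.sum_congr rfl fun k _ => ?_
  have h1 : √(Real.exp (c + (k + 1) * d)) =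
      √u * Real.exp (-(Real.log u - c - (k + 1) * d) / 2) := by
    rw [← Real.exp_half, ← Real.exp_log (Real.sqrt_pos.2 hu), Real.log_sqrt hu.le, ← Real.exp_add]
    congr 1
    ring
  have h2 : max (√u - √(Real.exp (c + (k + 1) * d))) 0 =
      √u * max (1 - Real.exp (-(Real.log u - c - (k + 1) * d) / 2)) 0 := by
    rw [h1, mul_max_of_nonneg _ _ (Real.sqrt_nonneg u), mul_zero, mul_sub, mul_one]
  rw [h2, mul_pow, Real.sq_sqrt hu.le]
  ring

end RealLemmas

/-! ### Hilbert-Schmidt sums, square roots and projection-valued measures. -/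

section HilbertLemmas

variable {H : Type*} [NormedAddCommGroup H] [InnerProductSpace ℂ H]

theorem ofReal_re_inner_self (x : H) : ENNReal.ofReal (⟪x, x⟫_ℂ).re = ‖x‖ₑ ^ 2 := by
  have h : (⟪x, x⟫_ℂ).re = ‖x‖ ^ 2 := (norm_sq_eq_re_inner (𝕜 := ℂ) x).symm
  rw [h, ← ofReal_norm, ENNReal.ofReal_pow (norm_nonneg x)]

/-- Parseval's identity in `[0, ∞]`. -/
theorem tsum_enorm_inner_sq {ι : Type*} (b : HilbertBasis ι ℂ H) (x : H) :
    ∑' i, ‖⟪b i, x⟫_ℂ‖ₑ ^ 2 = ‖x‖ₑ ^ 2 := by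
  have h := (b.hasSum_inner_mul_inner x x).mapL Complex.reCLM
  have e : ∀ i, Complex.reCLM (⟪x, b i⟫_ℂ * ⟪b i, x⟫_ℂ) = ‖⟪b i, x⟫_ℂ‖ ^ 2 := by
    intro i
    rw [← inner_conj_symm x (b i), mul_comm, Complex.mul_conj, Complex.reCLM_apply,
      Complex.ofReal_re, Complex.normSq_eq_norm_sq]
  simp only [e] at h
  rw [← ofReal_re_inner_self, ← Complex.reCLM_apply, ← h.tsum_eq,
    ENNReal.ofReal_tsum_of_nonneg (fun i => sq_nonneg _) h.summable]
  refine tsum_congr fun i => ?_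
  rw [← ofReal_norm, ENNReal.ofReal_pow (norm_nonneg _)]

variable [CompleteSpace H]

/-- An operator and its adjoint have the same Hilbert-Schmidt norm. -/
theorem tsum_enorm_sq_adjoint {ι : Type*} (b : HilbertBasis ι ℂ H) (T : H →L[ℂ] H) :
    ∑' i, ‖T (b i)‖ₑ ^ 2 = ∑' i, ‖T.adjoint (b i)‖ₑ ^ 2 := by
  simp only [← tsum_enorm_inner_sq b]
  rw [ENNReal.tsum_comm]
  refine tsum_congr fun i => tsum_congr fun j => ?_
  rw [← T.adjoint_inner_left, ← inner_conj_symm]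
  congr 1
  exact RCLike.enorm_conj _

/-- Passing to adjoints preserves the Hilbert-Schmidt sum and moves `R` to the outside, where its
operator norm bounds each term. -/
theorem IsSelfAdjoint.tsum_enorm_sq_comp_le {ι : Type*} (b : HilbertBasis ι ℂ H)
    (T : H →L[ℂ] H) {R : H →L[ℂ] H} (hR : IsSelfAdjoint R) :
    ∑' i, ‖T (R (b i))‖ₑ ^ 2 ≤ ‖R‖ₑ ^ 2 * ∑' i, ‖T (b i)‖ₑ ^ 2 := by
  have h1 := tsum_enorm_sq_adjoint b (T ∘L R)
  rw [ContinuousLinearMap.adjoint_comp, hR.adjoint_eq] at h1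
  calc ∑' i, ‖T (R (b i))‖ₑ ^ 2 = ∑' i, ‖R (T.adjoint (b i))‖ₑ ^ 2 := h1
    _ ≤ ∑' i, ‖R‖ₑ ^ 2 * ‖T.adjoint (b i)‖ₑ ^ 2 := by
      refine ENNReal.tsum_le_tsum fun i => ?_
      rw [← mul_pow]
      gcongr
      exact R.le_opENorm _
    _ = ‖R‖ₑ ^ 2 * ∑' i, ‖T (b i)‖ₑ ^ 2 := by
      rw [ENNReal.tsum_mul_left, ← tsum_enorm_sq_adjoint]

theorem isSelfAdjoint_sqrtOp (T : H →L[ℂ] H) : IsSelfAdjoint (sqrtOp T) :=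
  (CFC.sqrt_nonneg T).isSelfAdjoint

theorem IsStarProjection.sqrtOp_eq {P : H →L[ℂ] H} (hP : IsStarProjection P) : sqrtOp P = P :=
  CFC.sqrt_unique hP.isIdempotentElem.eq hP.nonneg

theorem enorm_sqrtOp_sq {ρ : H →L[ℂ] H} (hρ : ρ.IsPositive) : ‖sqrtOp ρ‖ₑ ^ 2 = ‖ρ‖ₑ := by
  have h0 : 0 ≤ ρ := ContinuousLinearMap.nonneg_iff_isPositive ρ |>.2 hρ
  have h1 : ‖sqrtOp ρ * sqrtOp ρ‖ = ‖sqrtOp ρ‖ * ‖sqrtOp ρ‖ := by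
    have := CStarRing.norm_star_mul_self (x := sqrtOp ρ)
    rwa [(isSelfAdjoint_sqrtOp ρ).star_eq] at this
  have h2 : sqrtOp ρ * sqrtOp ρ = ρ := CFC.sqrt_mul_sqrt_self ρ h0
  rw [h2] at h1
  rw [← ofReal_norm, ← ofReal_norm, h1, ← sq, ENNReal.ofReal_pow (norm_nonneg _)]

theorem trace_eq_tsum_enorm_sqrtOp_sq {ρ : H →L[ℂ] H} (hρ : ρ.IsPositive) :
    trace ρ = ∑' i, ‖sqrtOp ρ (hilbBasis H i)‖ₑ ^ 2 := by
  have h0 : 0 ≤ ρ := ContinuousLinearMap.nonneg_iff_isPositive ρ |>.2 hρ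
  have h2 : sqrtOp ρ * sqrtOp ρ = ρ := CFC.sqrt_mul_sqrt_self ρ h0
  refine tsum_congr fun i => ?_
  rw [← ofReal_re_inner_self]
  conv_lhs => rw [← h2]
  rw [mul_apply_eq_comp, ← ContinuousLinearMap.adjoint_inner_right,
    (isSelfAdjoint_sqrtOp ρ).adjoint_eq]

namespace ProjMeasure

variable (E : ProjMeasure H)

theorem dist_eq_enorm_sq (x : H) {B : Set ℝ} (hB : MeasurableSet B) :
    E.dist x B = ‖E.proj B x‖ₑ ^ 2 := by
  have h := E.isStarProjection B hB
  rw [E.dist_apply x hB, ← ofReal_re_inner_self]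
  conv_lhs => rw [← h.isIdempotentElem.eq]
  rw [mul_apply_eq_comp, ← ContinuousLinearMap.adjoint_inner_right,
    h.isSelfAdjoint.adjoint_eq]

theorem dist_univ (x : H) : E.dist x Set.univ = ‖x‖ₑ ^ 2 := by
  rw [E.dist_eq_enorm_sq x MeasurableSet.univ, E.proj_univ, one_apply_eq_self]

theorem enorm_proj_mono {B C : Set ℝ} (hB : MeasurableSet B) (hC : MeasurableSet C)
    (h : B ⊆ C) (x : H) : ‖E.proj B x‖ₑ ^ 2 ≤ ‖E.proj C x‖ₑ ^ 2 := by
  rw [← E.dist_eq_enorm_sq x hB, ← E.dist_eq_enorm_sq x hC]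
  exact measure_mono h

theorem proj_add_proj_compl {B : Set ℝ} (hB : MeasurableSet B) (x : H) :
    E.proj B x + E.proj Bᶜ x = x := by
  -- Additivity is given only for sequences, so the pair is padded with empty sets.
  let C : ℕ → Set ℝ := fun n => if n = 0 then B else if n = 1 then Bᶜ else ∅
  have hC : ∀ n, MeasurableSet (C n) := by
    intro n
    dsimp only [C]
    split_ifs
    exacts [hB, hB.compl, MeasurableSet.empty]
  have hd : Pairwise fun m n => Disjoint (C m) (C n) := by
    intro m n hmn
    dsimp only [C]
    split_ifs <;> first | omega | simp [disjoint_compl_left, disjoint_compl_right]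
  have hU : ⋃ n, C n = Set.univ := by
    refine Set.eq_univ_of_forall fun r => Set.mem_iUnion.2 ?_
    by_cases hr : r ∈ B
    · exact ⟨0, by simpa [C] using hr⟩
    · exact ⟨1, by simpa [C] using hr⟩
  have h := E.hasSum_iUnion C hC hd x
  rw [hU, E.proj_univ] at h
  have h2 : HasSum (fun n => E.proj (C n) x) (∑ n ∈ Finset.range 2, E.proj (C n) x) := by
    refine hasSum_sum_of_ne_finset_zero fun n hn => ?_
    have : 2 ≤ n := by simpa [Nat.succ_le_iff] using hn
    have h0 : C n = ∅ := by
      dsimp only [C]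
      rw [if_neg (by omega), if_neg (by omega)]
    simp [h0, E.proj_empty]
  have h3 := h2.unique h
  simpa [Finset.sum_range_succ, C] using h3

end ProjMeasure

end HilbertLemmas

/-! ### Density measures of operators and of spectral projections. -/

section DensityLemmas

variable {X : Type*} [MeasurableSpace X] {μ : Measure X}
  {V : Type*} [NormedAddCommGroup V] [InnerProductSpace ℂ V] [CompleteSpace V]

theorem densMeasure_apply (P : Lp V 2 μ →L[ℂ] Lp V 2 μ) {s : Set X} (hs : MeasurableSet s) :
    densMeasure P s =
      ∑' i, ‖indicatorOp μ V hs (sqrtOp P (hilbBasis (Lp V 2 μ) i))‖ₑ ^ 2 := by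
  rw [densMeasure, Measure.sum_apply _ hs]
  refine tsum_congr fun i => ?_
  rw [withDensity_apply _ hs, enorm_indicatorOp_sq]

theorem densMeasure_univ {ρ : Lp V 2 μ →L[ℂ] Lp V 2 μ} (hρ : ρ.IsPositive) :
    densMeasure ρ Set.univ = trace ρ := by
  rw [trace_eq_tsum_enorm_sqrtOp_sq hρ, densMeasure, Measure.sum_apply _ MeasurableSet.univ]
  refine tsum_congr fun i => ?_
  rw [withDensity_apply _ MeasurableSet.univ, Measure.restrict_univ, lintegral_enorm_sq_coeFn]

theorem densMeasure_absolutelyContinuous (P : Lp V 2 μ →L[ℂ] Lp V 2 μ) : densMeasure P ≪ μ :=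
  Measure.absolutelyContinuous_sum_left fun _ => withDensity_absolutelyContinuous _ _

theorem measurable_dens (P : Lp V 2 μ →L[ℂ] Lp V 2 μ) : Measurable (dens P) :=
  Measure.measurable_rnDeriv _ _

theorem withDensity_dens [SigmaFinite μ] (P : Lp V 2 μ →L[ℂ] Lp V 2 μ) :
    μ.withDensity (dens P) = densMeasure P := by
  have := haveLebesgueDecomposition_of_absolutelyContinuous (densMeasure_absolutelyContinuous P)
  exact Measure.withDensity_rnDeriv_eq _ _ (densMeasure_absolutelyContinuous P)

/-- Turns bounds on `F_A` into inequalities of measures, which can be checked set by set with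
Hilbert-Schmidt sums. -/
theorem essSup_dens_le_iff [SigmaFinite μ] (P : Lp V 2 μ →L[ℂ] Lp V 2 μ) (C : ℝ≥0∞) :
    essSup (dens P) μ ≤ C ↔ densMeasure P ≤ C • μ := by
  rw [← withDensity_dens P, ← withDensity_const, withDensity_le_iff_ae_le (measurable_dens P)]
  exact ⟨fun h => (ENNReal.ae_le_essSup (dens P)).mono fun x hx => hx.trans h, essSup_le_of_ae_le C⟩

variable (A : Lp V 2 μ →ₗ.[ℂ] Lp V 2 μ)

theorem isStarProjection_specProj (l : ℝ) : IsStarProjection (specProj A l) :=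
  (spectralMeasure A).isStarProjection _ measurableSet_Iio

theorem densMeasure_specProj_apply (l : ℝ) {s : Set X} (hs : MeasurableSet s) :
    densMeasure (specProj A l) s =
      ∑' i, ‖indicatorOp μ V hs (specProj A l (hilbBasis (Lp V 2 μ) i))‖ₑ ^ 2 := by
  rw [densMeasure_apply _ hs, IsStarProjection.sqrtOp_eq (isStarProjection_specProj A l)]

/-- With the projection outermost, each term is monotone in `l`. -/
theorem densMeasure_specProj_apply_adjoint (l : ℝ) {s : Set X} (hs : MeasurableSet s) :
    densMeasure (specProj A l) s =
      ∑' i, ‖specProj A l (indicatorOp μ V hs (hilbBasis (Lp V 2 μ) i))‖ₑ ^ 2 := by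
  rw [densMeasure_specProj_apply A l hs]
  have h := tsum_enorm_sq_adjoint (hilbBasis (Lp V 2 μ)) (indicatorOp μ V hs ∘L specProj A l)
  rwa [ContinuousLinearMap.adjoint_comp, (isSelfAdjoint_indicatorOp hs).adjoint_eq,
    (isStarProjection_specProj A l).isSelfAdjoint.adjoint_eq] at h

theorem densMeasure_specProj_mono : Monotone fun l => densMeasure (specProj A l) := by
  intro l l' hl
  refine Measure.le_iff.2 fun s hs => ?_
  rw [densMeasure_specProj_apply_adjoint A l hs, densMeasure_specProj_apply_adjoint A l' hs]
  exact ENNReal.tsum_le_tsum fun i => (spectralMeasure A).enorm_proj_mono measurableSet_Iio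
    measurableSet_Iio (Set.Iio_subset_Iio hl) _

theorem specDensity_mono [SigmaFinite μ] : Monotone (specDensity A) := fun _ l' hl =>
  (essSup_dens_le_iff _ _).2 <| (densMeasure_specProj_mono A hl).trans <|
    (essSup_dens_le_iff _ _).1 (le_refl (specDensity A l'))

/-- The low-energy part of a positive operator `ρ` has density at most `‖ρ‖ F_A(l)`. -/
theorem sum_withDensity_specProj_le [SigmaFinite μ] {ρ : Lp V 2 μ →L[ℂ] Lp V 2 μ}
    (hρ : ρ.IsPositive) (l : ℝ) :
    Measure.sum (fun i => μ.withDensity fun x =>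
        ‖(specProj A l (sqrtOp ρ (hilbBasis (Lp V 2 μ) i)) : Lp V 2 μ) x‖ₑ ^ 2) ≤
      (‖ρ‖ₑ * specDensity A l) • μ := by
  refine Measure.le_iff.2 fun s hs => ?_
  rw [Measure.sum_apply _ hs]
  calc ∑' i, μ.withDensity (fun x =>
          ‖(specProj A l (sqrtOp ρ (hilbBasis (Lp V 2 μ) i)) : Lp V 2 μ) x‖ₑ ^ 2) s
      = ∑' i, ‖(indicatorOp μ V hs ∘L specProj A l)
          (sqrtOp ρ (hilbBasis (Lp V 2 μ) i))‖ₑ ^ 2 := by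
        refine tsum_congr fun i => ?_
        rw [withDensity_apply _ hs, ContinuousLinearMap.comp_apply, enorm_indicatorOp_sq]
    _ ≤ ‖sqrtOp ρ‖ₑ ^ 2 * ∑' i, ‖(indicatorOp μ V hs ∘L specProj A l)
          (hilbBasis (Lp V 2 μ) i)‖ₑ ^ 2 :=
        IsSelfAdjoint.tsum_enorm_sq_comp_le _ _ (isSelfAdjoint_sqrtOp ρ)
    _ = ‖ρ‖ₑ * densMeasure (specProj A l) s := by
        rw [enorm_sqrtOp_sq hρ, densMeasure_specProj_apply A l hs]
        rfl
    _ ≤ ‖ρ‖ₑ * (specDensity A l * μ s) := by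
        gcongr
        exact (essSup_dens_le_iff _ _).1 (le_refl (specDensity A l)) s
    _ = _ := by rw [Measure.smul_apply, smul_eq_mul, mul_assoc]

end DensityLemmas

/-! ### Concave hulls and Legendre duality in `EReal`. -/

section ConcaveLemmas

variable {f : ℝ → EReal}

theorem le_add_of_negLegendre_le {t c : ℝ} (h : negLegendre f t ≤ c) (x : ℝ) :
    f x ≤ ((c + t * x : ℝ) : EReal) := by
  have h1 : f x - ((t * x : ℝ) : EReal) ≤ c := (le_iSup (fun x : ℝ => f x - ((t * x : ℝ) : EReal)) x).trans h
  rw [EReal.sub_le_iff_le_add (Or.inl (EReal.coe_ne_bot _)) (Or.inl (EReal.coe_ne_top _))] at h1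
  rwa [EReal.coe_add]

theorem negLegendre_le_of_le_add {t c : ℝ} (h : ∀ x, f x ≤ ((c + t * x : ℝ) : EReal)) :
    negLegendre f t ≤ c := by
  refine iSup_le fun x => ?_
  rw [EReal.sub_le_iff_le_add (Or.inl (EReal.coe_ne_bot _)) (Or.inl (EReal.coe_ne_top _)),
    ← EReal.coe_add]
  exact h x

/-- If `s ≤ c + y` for all real `c` above `m < ∞`, and `y < ∞`, then `s ≤ m + y`. -/
theorem le_add_of_forall_real_le {s m y : EReal} (hm : m ≠ ⊤) (hy : y ≠ ⊤)
    (h : ∀ c : ℝ, m < c → s ≤ c + y) : s ≤ m + y := by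
  induction y with
  | top => exact absurd rfl hy
  | bot =>
    obtain ⟨c, hc, -⟩ := EReal.lt_iff_exists_real_btwn.1 (lt_top_iff_ne_top.2 hm)
    simpa using h c hc
  | coe y =>
    rw [← EReal.sub_le_iff_le_add (Or.inl (EReal.coe_ne_bot _)) (Or.inl (EReal.coe_ne_top _))]
    refine le_of_forall_gt_imp_ge_of_dense fun a ha => ?_
    obtain ⟨c, hc, hca⟩ := EReal.lt_iff_exists_real_btwn.1 ha
    refine le_trans ?_ hca.le
    rw [EReal.sub_le_iff_le_add (Or.inl (EReal.coe_ne_bot _)) (Or.inl (EReal.coe_ne_top _))]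
    exact h c hc

/-- The right derivative is a supergradient, by the slope inequalities for the convex function `-g`.
-/
theorem ConcaveOn.exists_le_add_mul {g : ℝ → ℝ} (hg : ConcaveOn ℝ Set.univ g) (e : ℝ) :
    ∃ t : ℝ, ∀ x, g x ≤ g e + t * (x - e) := by
  refine ⟨derivWithin g (Set.Ioi e) e, fun x => ?_⟩
  have hn := hg.neg
  have hR : derivWithin (-g) (Set.Ioi e) e = -derivWithin g (Set.Ioi e) e := derivWithin.neg ..
  have he : e ∈ interior (Set.univ : Set ℝ) := by simp
  rcases lt_trichotomy x e with h | h | h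
  · have h1 := (hn.slope_le_leftDeriv_of_mem_interior trivial he h).trans
      (hn.leftDeriv_le_rightDeriv_of_mem_interior he)
    rw [hR, slope_def_field, div_le_iff₀ (by linarith)] at h1
    simp only [Pi.neg_apply] at h1
    linarith
  · simp [h]
  · have h1 := hn.rightDeriv_le_slope_of_mem_interior he trivial h
    rw [hR, slope_def_field, le_div_iff₀ (by linarith)] at h1
    simp only [Pi.neg_apply] at h1
    linarith

theorem concaveHull_le {t : ℝ} (ht : negLegendre f t ≠ ⊤) (e : ℝ) :
    concaveHull f e ≤ negLegendre f t + ((t * e : ℝ) : EReal) := by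
  refine le_add_of_forall_real_le ht (EReal.coe_ne_top _) fun c hc => ?_
  rw [← EReal.coe_add]
  refine iInf₂_le_of_le (fun x => c + t * x) ?_ (iInf_le_of_le ?_ le_rfl)
  · refine ⟨convex_univ, fun x _ y _ a b _ _ hab => le_of_eq ?_⟩
    simp only [smul_eq_mul]
    linear_combination c * hab
  · exact le_add_of_negLegendre_le hc.le

theorem exists_negLegendre_le_of_concave {g : ℝ → ℝ} (hg : ConcaveOn ℝ Set.univ g)
    (hfg : ∀ x, f x ≤ (g x : EReal)) (e : ℝ) :
    ∃ t : ℝ, negLegendre f t ≤ ((g e - t * e : ℝ) : EReal) := by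
  obtain ⟨t, ht⟩ := ConcaveOn.exists_le_add_mul hg e
  refine ⟨t, negLegendre_le_of_le_add fun x => (hfg x).trans (EReal.coe_le_coe_iff.2 ?_)⟩
  linarith [ht x]

/-- Affine majorants are concave, and conversely the supporting line at `e` of a concave majorant is
an affine majorant with the same value at `e`. -/
theorem le_concaveHull_iff (s : EReal) (e : ℝ) :
    s ≤ concaveHull f e ↔
      ∀ t : ℝ, negLegendre f t ≠ ⊤ → s ≤ negLegendre f t + ((t * e : ℝ) : EReal) := by
  refine ⟨fun h t ht => h.trans (concaveHull_le ht e), fun h => ?_⟩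
  refine le_iInf₂ fun g hg => le_iInf fun hfg => ?_
  obtain ⟨t, ht⟩ := exists_negLegendre_le_of_concave hg hfg e
  refine (h t (ht.trans_lt (EReal.coe_lt_top _)).ne).trans ?_
  refine (add_le_add_left ht _).trans_eq ?_
  rw [← EReal.coe_add]
  simp

/-- A monotone function below a decreasing line is bounded at `x` by the values of that line
arbitrarily far to the right. -/
theorem eq_bot_of_negLegendre_ne_top (hf : Monotone f) {t : ℝ} (ht : t < 0)
    (h : negLegendre f t ≠ ⊤) (x : ℝ) : f x = ⊥ := by
  obtain ⟨c, hc, -⟩ := EReal.lt_iff_exists_real_btwn.1 (lt_top_iff_ne_top.2 h)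
  refine (EReal.eq_bot_iff_forall_lt _).2 fun r => ?_
  have h1 : f x ≤ ((r - 1 : ℝ) : EReal) := by
    refine (hf (le_max_left x ((r - 1 - c) / t))).trans
      ((le_add_of_negLegendre_le hc.le _).trans (EReal.coe_le_coe_iff.2 ?_))
    have h2 : t * max x ((r - 1 - c) / t) ≤ t * ((r - 1 - c) / t) :=
      mul_le_mul_of_nonpos_left (le_max_right _ _) ht.le
    rw [mul_div_cancel₀ _ ht.ne] at h2
    linarith
  exact h1.trans_lt (EReal.coe_lt_coe_iff.2 (by linarith))

theorem negLegendre_eq_bot (hf : ∀ x, f x = ⊥) (t : ℝ) : negLegendre f t = ⊥ := by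
  simp [negLegendre, hf]

/-- The concave hull of a monotone function is the infimum of its affine majorants, also at `-∞`. -/
theorem le_extendBot_concaveHull_iff (hf : Monotone f) (s : EReal) {e : EReal} (he : e < ⊤) :
    s ≤ extendBot (concaveHull f) e ↔
      ∀ t : ℝ, negLegendre f t ≠ ⊤ → s ≤ negLegendre f t + (t : EReal) * e := by
  induction e with
  | top => exact absurd he (lt_irrefl _)
  | coe e =>
    simp only [extendBot, EReal.coe_ne_bot, if_false, EReal.toReal_coe, le_concaveHull_iff,
      EReal.coe_mul]
  | bot =>
    simp only [extendBot, if_true, le_iInf_iff, le_concaveHull_iff]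
    refine ⟨fun h t ht => ?_, fun h x t ht => ?_⟩
    · rcases lt_trichotomy t 0 with h0 | h0 | h0
      -- Here `f` is identically `⊥`, so the Legendre term is `⊥` and absorbs `t * ⊥ = ⊤`.
      · have := h 0 t ht
        rw [negLegendre_eq_bot (eq_bot_of_negLegendre_ne_top hf h0 ht)] at this ⊢
        simpa using this
      · subst h0
        simpa using h 0 0 ht
      · obtain ⟨c, hc, -⟩ := EReal.lt_iff_exists_real_btwn.1 (lt_top_iff_ne_top.2 ht)
        rw [EReal.coe_mul_bot_of_pos h0, EReal.add_bot, le_bot_iff,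
          EReal.eq_bot_iff_forall_lt]
        intro r
        -- At this point the line `c + t x` takes the value `r - 1`.
        have h1 := (h ((r - 1 - c) / t) t ht).trans (add_le_add_left hc.le _)
        rw [mul_div_cancel₀ _ h0.ne', ← EReal.coe_add] at h1
        exact h1.trans_lt (EReal.coe_lt_coe_iff.2 (by linarith))
    · rcases lt_trichotomy t 0 with h0 | h0 | h0
      · have := h t ht
        rw [negLegendre_eq_bot (eq_bot_of_negLegendre_ne_top hf h0 ht)] at this ⊢
        simpa using this
      · subst h0
        simpa using h 0 ht
      · have := h t ht
        rw [EReal.coe_mul_bot_of_pos h0, EReal.add_bot, le_bot_iff] at this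
        simp [this]

theorem exists_negLegendre_ne_top {e : EReal} (h : extendBot (concaveHull f) e < ⊤) :
    ∃ t : ℝ, negLegendre f t ≠ ⊤ := by
  obtain ⟨x, hx⟩ : ∃ x : ℝ, concaveHull f x < ⊤ := by
    unfold extendBot at h
    split_ifs at h
    · exact iInf_lt_iff.1 h
    · exact ⟨_, h⟩
  -- With no finite Legendre value the affine criterion is vacuous, so even `⊤` lies below the hull.
  by_contra! hc
  refine hx.ne (top_le_iff.1 ((le_concaveHull_iff ⊤ x).2 fun t ht => absurd (hc t) ht))

end ConcaveLemmas

/-! ### Layer cake for the energy, and the spectral distribution of the state. -/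

section EnergyLemmas

theorem sum_ite_le_max {d : ℝ} (hd : 0 ≤ d) (r : ℝ) (N : ℕ) :
    (∑ k ∈ Finset.range N, if ((k : ℝ) + 1) * d ≤ r then d else 0) ≤ max r 0 := by
  induction N with
  | zero => simp
  | succ N ih =>
    by_cases h : ((N : ℝ) + 1) * d ≤ r
    · refine le_trans ?_ (h.trans (le_max_left _ _))
      refine (Finset.sum_le_card_nsmul _ _ d fun k _ => ?_).trans_eq ?_
      · split_ifs <;> simp [hd]
      · simp
    · rw [Finset.sum_range_succ, if_neg h, add_zero]
      exact ih

/-- A lower Riemann sum for `∫ (r - a)₊ dκ(r)`, written as an integral of `κ [l, ∞[` over `l`. -/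
theorem tsum_mul_measure_Ici_le (κ : Measure ℝ) {t d : ℝ} (ht : 0 < t) (hd : 0 ≤ d) (a : ℝ) :
    ∑' k : ℕ, ENNReal.ofReal d * κ (Set.Ici (a + (k + 1) * d / t)) ≤
      ENNReal.ofReal t * ∫⁻ r, ENNReal.ofReal (r - a) ∂κ := by
  have h1 : ∀ k : ℕ, ENNReal.ofReal d * κ (Set.Ici (a + (k + 1) * d / t)) =
      ∫⁻ r, ENNReal.ofReal (if ((k : ℝ) + 1) * d ≤ t * (r - a) then d else 0) ∂κ := by
    intro k
    rw [← lintegral_indicator_const measurableSet_Ici]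
    refine lintegral_congr fun r => ?_
    have h : r ∈ Set.Ici (a + ((k : ℝ) + 1) * d / t) ↔ ((k : ℝ) + 1) * d ≤ t * (r - a) := by
      rw [Set.mem_Ici, ← le_sub_iff_add_le', div_le_iff₀' ht]
    by_cases h2 : ((k : ℝ) + 1) * d ≤ t * (r - a)
    · rw [Set.indicator_of_mem (h.2 h2), if_pos h2]
    · rw [Set.indicator_of_notMem (fun h3 => h2 (h.1 h3)), if_neg h2, ENNReal.ofReal_zero]
  have hm : ∀ k : ℕ, Measurable fun r : ℝ =>
      ENNReal.ofReal (if ((k : ℝ) + 1) * d ≤ t * (r - a) then d else 0) := fun k =>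
    ENNReal.measurable_ofReal.comp <| Measurable.ite
      (measurableSet_le measurable_const (by fun_prop)) measurable_const measurable_const
  simp only [h1]
  rw [← lintegral_tsum fun k => (hm k).aemeasurable, ← lintegral_const_mul _ (by fun_prop)]
  refine lintegral_mono fun r => ?_
  rw [ENNReal.tsum_eq_iSup_nat]
  refine iSup_le fun N => ?_
  rw [← ENNReal.ofReal_sum_of_nonneg (fun k _ => by split_ifs <;> simp [hd]),
    ← ENNReal.ofReal_mul ht.le]
  refine (ENNReal.ofReal_le_ofReal (sum_ite_le_max hd _ N)).trans_eq ?_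
  rcases le_total 0 (t * (r - a)) with h | h
  · rw [max_eq_left h]
  · rw [max_eq_right h, ENNReal.ofReal_zero, ENNReal.ofReal_of_nonpos h]

variable {H : Type*} [NormedAddCommGroup H] [InnerProductSpace ℂ H] [CompleteSpace H]

/-- The spectral distribution of the state `ρ`: the measure `B ↦ τ(ρ^{1/2} E(B) ρ^{1/2})`. -/
def stateDist (A : H →ₗ.[ℂ] H) (ρ : H →L[ℂ] H) : Measure ℝ :=
  Measure.sum fun i => (spectralMeasure A).dist (sqrtOp ρ (hilbBasis H i))

theorem energyOf_eq_lintegral (A : H →ₗ.[ℂ] H) (f : ℝ → ℝ≥0∞) (ρ : H →L[ℂ] H) :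
    energyOf A f ρ = ∫⁻ l, f l ∂(stateDist A ρ) :=
  (lintegral_sum_measure _ _).symm

theorem stateDist_univ (A : H →ₗ.[ℂ] H) {ρ : H →L[ℂ] H} (hρ : ρ.IsPositive) :
    stateDist A ρ Set.univ = trace ρ := by
  rw [stateDist, Measure.sum_apply _ MeasurableSet.univ, trace_eq_tsum_enorm_sqrtOp_sq hρ]
  simp only [ProjMeasure.dist_univ]

theorem stateDist_apply (A : H →ₗ.[ℂ] H) (ρ : H →L[ℂ] H) {B : Set ℝ} (hB : MeasurableSet B) :
    stateDist A ρ B =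
      ∑' i, ‖(spectralMeasure A).proj B (sqrtOp ρ (hilbBasis H i))‖ₑ ^ 2 := by
  rw [stateDist, Measure.sum_apply _ hB]
  simp only [ProjMeasure.dist_eq_enorm_sq _ _ hB]

/-- The Hilbert basis may be uncountable; finite trace leaves countably many relevant vectors, so
that pointwise sums are measurable and null sets can be collected. -/
theorem countable_support_sqrtOp {ρ : H →L[ℂ] H} (hρ : ρ.IsPositive) (hτ : trace ρ ≠ ⊤) :
    {i | sqrtOp ρ (hilbBasis H i) ≠ 0}.Countable := by
  rw [trace_eq_tsum_enorm_sqrtOp_sq hρ] at hτ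
  refine (Summable.countable_support_ennreal hτ).mono fun i hi => ?_
  simpa using hi

end EnergyLemmas

/-! ### Splitting the density at an energy level and integrating over levels. -/

section HighEnergy

variable {X : Type*} [MeasurableSpace X] {μ : Measure X}
  {V : Type*} [NormedAddCommGroup V]

theorem sum_withDensity_eq {ι : Type*} {J : Set ι} (hJ : J.Countable) {g : ι → Lp V 2 μ}
    (hg : ∀ i ∉ J, g i = 0) :
    Measure.sum (fun i => μ.withDensity fun x => ‖g i x‖ₑ ^ 2) =
      μ.withDensity fun x => ∑' i : J, ‖g i x‖ₑ ^ 2 := by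
  have := hJ.to_subtype
  have h1 : (fun x => ∑' i : J, ‖g i x‖ₑ ^ 2) = ∑' i : J, fun x => ‖g i x‖ₑ ^ 2 := by
    ext x
    rw [ENNReal.tsum_apply]
  rw [h1, withDensity_tsum fun i : J => measurable_enorm_sq_coeFn (g i)]
  ext s hs
  rw [Measure.sum_apply _ hs, Measure.sum_apply _ hs]
  refine (tsum_subtype_eq_of_support_subset (f := fun i =>
    μ.withDensity (fun x => ‖g i x‖ₑ ^ 2) s) fun i hi => ?_).symm
  by_contra h
  refine hi ?_
  have h2 : ∀ᵐ x ∂μ, g i x = 0 := by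
    rw [hg i h]
    exact Lp.coeFn_zero _ _ _
  simp only
  rw [withDensity_apply _ hs]
  refine (lintegral_congr_ae ?_).trans lintegral_zero
  filter_upwards [ae_restrict_of_ae h2] with x hx
  simp [hx]

variable [InnerProductSpace ℂ V] [CompleteSpace V]

/-- The density of the part of `ρ` of energy at least `l`, the sum being restricted to the
countably many basis vectors which `ρ^{1/2}` does not annihilate. -/
def highDens (A : Lp V 2 μ →ₗ.[ℂ] Lp V 2 μ) (ρ : Lp V 2 μ →L[ℂ] Lp V 2 μ) (l : ℝ) (x : X) :
    ℝ≥0∞ :=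
  ∑' i : {i | sqrtOp ρ (hilbBasis (Lp V 2 μ) i) ≠ 0},
    ‖((spectralMeasure A).proj (Set.Iio l)ᶜ (sqrtOp ρ (hilbBasis (Lp V 2 μ) i)) : Lp V 2 μ) x‖ₑ ^ 2

variable (A : Lp V 2 μ →ₗ.[ℂ] Lp V 2 μ) {ρ : Lp V 2 μ →L[ℂ] Lp V 2 μ}

theorem measurable_highDens (hρ : ρ.IsPositive) (hτ : trace ρ ≠ ⊤) (l : ℝ) :
    Measurable (highDens A ρ l) := by
  have := (countable_support_sqrtOp hρ hτ).to_subtype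
  exact Measurable.tsum fun i => measurable_enorm_sq_coeFn _

theorem lintegral_highDens_le (hρ : ρ.IsPositive) (hτ : trace ρ ≠ ⊤) (l : ℝ) :
    ∫⁻ x, highDens A ρ l x ∂μ ≤ stateDist A ρ (Set.Ici l) := by
  have := (countable_support_sqrtOp hρ hτ).to_subtype
  unfold highDens
  rw [lintegral_tsum fun i => (measurable_enorm_sq_coeFn _).aemeasurable,
    stateDist_apply A ρ measurableSet_Ici, ← Set.compl_Iio]
  simp only [lintegral_enorm_sq_coeFn]
  exact ENNReal.tsum_comp_le_tsum_of_injective Subtype.val_injective fun i =>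
    ‖(spectralMeasure A).proj (Set.Iio l)ᶜ (sqrtOp ρ (hilbBasis (Lp V 2 μ) i))‖ₑ ^ 2

/-- The density of `ρ` splits into a low-energy and a high-energy part. -/
theorem dens_rpow_le [SigmaFinite μ] (hρ : ρ.IsPositive) (hτ : trace ρ ≠ ⊤) (l : ℝ) :
    ∀ᵐ x ∂μ, dens ρ x ^ (1 / 2 : ℝ) ≤
      (‖ρ‖ₑ * specDensity A l) ^ (1 / 2 : ℝ) + highDens A ρ l x ^ (1 / 2 : ℝ) := by
  have hJ := countable_support_sqrtOp hρ hτ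
  have := hJ.to_subtype
  set J := {i | sqrtOp ρ (hilbBasis (Lp V 2 μ) i) ≠ 0} with hJdef
  have h0 : ∀ i ∉ J, sqrtOp ρ (hilbBasis (Lp V 2 μ) i) = 0 := fun i hi => by
    simpa [hJdef] using hi
  have h1 : dens ρ ≤ᵐ[μ] fun x => ∑' i : J, ‖sqrtOp ρ (hilbBasis (Lp V 2 μ) i) x‖ₑ ^ 2 := by
    rw [← withDensity_le_iff_ae_le (measurable_dens ρ), withDensity_dens,
      ← sum_withDensity_eq hJ h0]
    exact le_rfl
  have h2 : (fun x => ∑' i : J,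
      ‖(specProj A l (sqrtOp ρ (hilbBasis (Lp V 2 μ) i)) : Lp V 2 μ) x‖ₑ ^ 2) ≤ᵐ[μ]
      fun _ => ‖ρ‖ₑ * specDensity A l := by
    rw [← withDensity_le_iff_ae_le (Measurable.tsum fun i => measurable_enorm_sq_coeFn _),
      ← sum_withDensity_eq hJ (g := fun i => specProj A l (sqrtOp ρ (hilbBasis (Lp V 2 μ) i)))
        (fun i hi => by rw [h0 i hi, map_zero]), withDensity_const]
    exact sum_withDensity_specProj_le A hρ l
  have h3 : ∀ᵐ x ∂μ, ∀ i : J, ‖sqrtOp ρ (hilbBasis (Lp V 2 μ) i) x‖ₑ ≤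
      ‖(specProj A l (sqrtOp ρ (hilbBasis (Lp V 2 μ) i)) : Lp V 2 μ) x‖ₑ +
      ‖((spectralMeasure A).proj (Set.Iio l)ᶜ
        (sqrtOp ρ (hilbBasis (Lp V 2 μ) i)) : Lp V 2 μ) x‖ₑ := by
    refine ae_all_iff.2 fun i => ?_
    have h4 := (spectralMeasure A).proj_add_proj_compl measurableSet_Iio (B := Set.Iio l)
      (sqrtOp ρ (hilbBasis (Lp V 2 μ) i))
    have h5 := Lp.coeFn_add ((spectralMeasure A).proj (Set.Iio l)
      (sqrtOp ρ (hilbBasis (Lp V 2 μ) i))) ((spectralMeasure A).proj (Set.Iio l)ᶜ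
      (sqrtOp ρ (hilbBasis (Lp V 2 μ) i)))
    rw [h4] at h5
    filter_upwards [h5] with x hx
    rw [hx]
    exact enorm_add_le _ _
  filter_upwards [h1, h2, h3] with x hx1 hx2 hx3
  calc dens ρ x ^ (1 / 2 : ℝ)
      ≤ (∑' i : J, (‖(specProj A l (sqrtOp ρ (hilbBasis (Lp V 2 μ) i)) : Lp V 2 μ) x‖ₑ +
        ‖((spectralMeasure A).proj (Set.Iio l)ᶜ
          (sqrtOp ρ (hilbBasis (Lp V 2 μ) i)) : Lp V 2 μ) x‖ₑ) ^ 2) ^ (1 / 2 : ℝ) := by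
        refine ENNReal.rpow_le_rpow (hx1.trans ?_) (by norm_num)
        exact ENNReal.tsum_le_tsum fun i => by gcongr; exact hx3 i
    -- Minkowski over the index `i` at fixed `x`, with the low and high parts as the two families.
    _ ≤ _ := tsum_add_sq_rpow_le _ _
    _ ≤ _ := by
        refine add_le_add (ENNReal.rpow_le_rpow hx2 (by norm_num)) le_rfl

/-- Real form of the splitting of the density of `ρ`. -/
theorem mul_ofReal_sq_le_highDens [SigmaFinite μ] (hρ : ρ.IsPositive) (hτ : trace ρ ≠ ⊤)
    (hρ0 : ρ ≠ 0) {l b : ℝ} (hl : specDensity A l ≤ ENNReal.ofReal (Real.exp b)) :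
    ∀ᵐ x ∂μ, dens ρ x ≠ ⊤ →
      ‖ρ‖ₑ * ENNReal.ofReal ((max (√((dens ρ x / ‖ρ‖ₑ).toReal) - √(Real.exp b)) 0) ^ 2) ≤
        highDens A ρ l x := by
  filter_upwards [dens_rpow_le A hρ hτ l] with x hx hfin
  by_cases hD : highDens A ρ l x = ⊤
  · simp [hD]
  have hn : 0 < ‖ρ‖ := norm_pos_iff.2 hρ0
  have h1 : dens ρ x ^ (1 / 2 : ℝ) ≤ (‖ρ‖ₑ * ENNReal.ofReal (Real.exp b)) ^ (1 / 2 : ℝ) +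
      highDens A ρ l x ^ (1 / 2 : ℝ) := hx.trans (by gcongr)
  have e1 : ‖ρ‖ₑ = ENNReal.ofReal ‖ρ‖ := (ofReal_norm ρ).symm
  obtain ⟨f, hf0, hf⟩ : ∃ f : ℝ, 0 ≤ f ∧ dens ρ x = ENNReal.ofReal f :=
    ⟨_, ENNReal.toReal_nonneg, (ENNReal.ofReal_toReal hfin).symm⟩
  obtain ⟨D, hD0, hD'⟩ : ∃ D : ℝ, 0 ≤ D ∧ highDens A ρ l x = ENNReal.ofReal D :=
    ⟨_, ENNReal.toReal_nonneg, (ENNReal.ofReal_toReal hD).symm⟩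
  rw [e1, hf, hD', ← ENNReal.ofReal_mul hn.le, ENNReal.ofReal_rpow_of_nonneg hf0 (by norm_num),
    ENNReal.ofReal_rpow_of_nonneg (by positivity) (by norm_num),
    ENNReal.ofReal_rpow_of_nonneg hD0 (by norm_num), ← ENNReal.ofReal_add (by positivity)
      (by positivity), ENNReal.ofReal_le_ofReal_iff (by positivity), ← Real.sqrt_eq_rpow,
    ← Real.sqrt_eq_rpow, ← Real.sqrt_eq_rpow, Real.sqrt_mul hn.le] at h1
  rw [e1, hf, hD', ← ENNReal.ofReal_div_of_pos hn, ENNReal.toReal_ofReal (by positivity),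
    ← ENNReal.ofReal_mul hn.le]
  refine ENNReal.ofReal_le_ofReal ?_
  have h2 : √‖ρ‖ * max (√(f / ‖ρ‖) - √(Real.exp b)) 0 ≤ √D := by
    rw [mul_max_of_nonneg _ _ (Real.sqrt_nonneg _), mul_zero, mul_sub, ← Real.sqrt_mul hn.le,
      mul_div_cancel₀ _ hn.ne']
    exact max_le (by linarith) (Real.sqrt_nonneg _)
  have h3 := pow_le_pow_left₀ (by positivity) h2 2
  rwa [mul_pow, Real.sq_sqrt hn.le, Real.sq_sqrt hD0] at h3

/-- The logarithm of the normalised density of `ρ`. -/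
def logDens (ρ : Lp V 2 μ →L[ℂ] Lp V 2 μ) (x : X) : ℝ := Real.log (dens ρ x / ‖ρ‖ₑ).toReal

theorem measurable_logDens (ρ : Lp V 2 μ →L[ℂ] Lp V 2 μ) : Measurable (logDens ρ) :=
  Real.measurable_log.comp ((measurable_dens ρ).div_const _).ennreal_toReal

theorem ae_dens_ne_top [SigmaFinite μ] (hρ : ρ.IsPositive) (hτ : trace ρ ≠ ⊤) :
    ∀ᵐ x ∂μ, dens ρ x ≠ ⊤ := by
  have : IsFiniteMeasure (densMeasure ρ) :=
    ⟨by rw [densMeasure_univ hρ]; exact lt_top_iff_ne_top.2 hτ⟩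
  exact Measure.rnDeriv_ne_top _ _

/-- The core estimate. The splitting is used at the levels `a + (k + 1) d / t`, where `F_A` is at
most `exp (c + (k + 1) d)`. Weighted by `d` and summed over `k`, the scalar inequality bounds the
logarithm from above pointwise, and the layer cake sum bounds the high parts by the energy above
`a`. -/
theorem lintegral_logDens_sub_le [SigmaFinite μ] (hρ : ρ.IsPositive) (hτ : trace ρ ≠ ⊤)
    (hρ0 : ρ ≠ 0) {t a c d : ℝ} (ht : 0 < t) (hd : 0 < d)
    (hF : ∀ l, a ≤ l → specDensity A l ≤ ENNReal.ofReal (Real.exp (c + t * (l - a)))) :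
    ∫⁻ x, ENNReal.ofReal (logDens ρ x - c - d - 3) ∂(densMeasure ρ) ≤
      ENNReal.ofReal t * energyOf A (fun l => ENNReal.ofReal (l - a)) ρ := by
  have hn : 0 < ‖ρ‖ := norm_pos_iff.2 hρ0
  have hk : ∀ k : ℕ, specDensity A (a + (k + 1) * d / t) ≤
      ENNReal.ofReal (Real.exp (c + (k + 1) * d)) := by
    intro k
    have h1 : 0 ≤ ((k : ℝ) + 1) * d / t := by positivity
    refine (hF _ (by linarith)).trans_eq ?_
    rw [add_sub_cancel_left, mul_div_cancel₀ _ ht.ne']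
  have hae := ae_all_iff.2 fun k => mul_ofReal_sq_le_highDens A hρ hτ hρ0 (hk k)
  have hpt : ∀ᵐ x ∂μ, dens ρ x * ENNReal.ofReal (logDens ρ x - c - d - 3) ≤
      ∑' k : ℕ, ENNReal.ofReal d * highDens A ρ (a + (k + 1) * d / t) x := by
    filter_upwards [hae, ae_dens_ne_top hρ hτ] with x hx hfin
    by_cases h0 : dens ρ x = 0
    · simp [h0]
    set u := (dens ρ x / ‖ρ‖ₑ).toReal with hu
    have e1 : ‖ρ‖ₑ ≠ 0 := by simpa using hρ0
    have hu1 : dens ρ x / ‖ρ‖ₑ = ENNReal.ofReal u :=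
      (ENNReal.ofReal_toReal (ENNReal.div_ne_top hfin e1)).symm
    have hu0 : 0 < u := ENNReal.toReal_pos (ENNReal.div_ne_zero.2 ⟨h0, enorm_ne_top⟩)
      (ENNReal.div_ne_top hfin e1)
    have hdens : dens ρ x = ‖ρ‖ₑ * ENNReal.ofReal u := by
      rw [← hu1, ENNReal.mul_div_cancel e1 enorm_ne_top]
    obtain ⟨N, hN⟩ := exists_mul_log_sub_le_sum_sq hd hu0 c
    calc dens ρ x * ENNReal.ofReal (logDens ρ x - c - d - 3)
        = ‖ρ‖ₑ * ENNReal.ofReal (u * (Real.log u - c - d - 3)) := by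
          rw [ENNReal.ofReal_mul hu0.le, ← mul_assoc, ← hdens]; rfl
      _ ≤ ‖ρ‖ₑ * ENNReal.ofReal (∑ k ∈ Finset.range N,
          d * (max (√u - √(Real.exp (c + (k + 1) * d))) 0) ^ 2) := by gcongr
      _ = ∑ k ∈ Finset.range N, ENNReal.ofReal d * (‖ρ‖ₑ *
          ENNReal.ofReal ((max (√u - √(Real.exp (c + (k + 1) * d))) 0) ^ 2)) := by
          rw [ENNReal.ofReal_sum_of_nonneg (fun k _ => by positivity), Finset.mul_sum]
          refine Finset.sum_congr rfl fun k _ => ?_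
          rw [ENNReal.ofReal_mul hd.le, mul_left_comm]
      _ ≤ ∑ k ∈ Finset.range N, ENNReal.ofReal d * highDens A ρ (a + (k + 1) * d / t) x :=
          Finset.sum_le_sum fun k _ => by gcongr; exact hx k hfin
      _ ≤ _ := ENNReal.sum_le_tsum _
  rw [← withDensity_dens ρ, lintegral_withDensity_eq_lintegral_mul _ (measurable_dens ρ)
    (by have := measurable_logDens ρ; fun_prop)]
  calc ∫⁻ x, (dens ρ * fun x => ENNReal.ofReal (logDens ρ x - c - d - 3)) x ∂μ
      ≤ ∫⁻ x, ∑' k : ℕ, ENNReal.ofReal d * highDens A ρ (a + (k + 1) * d / t) x ∂μ :=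
        lintegral_mono_ae hpt
    _ = ∑' k : ℕ, ENNReal.ofReal d * ∫⁻ x, highDens A ρ (a + (k + 1) * d / t) x ∂μ := by
        rw [lintegral_tsum fun k => ((measurable_highDens A hρ hτ _).const_mul _).aemeasurable]
        exact tsum_congr fun k => lintegral_const_mul _ (measurable_highDens A hρ hτ _)
    _ ≤ ∑' k : ℕ, ENNReal.ofReal d * stateDist A ρ (Set.Ici (a + (k + 1) * d / t)) :=
        ENNReal.tsum_le_tsum fun k => by gcongr; exact lintegral_highDens_le A hρ hτ _
    _ ≤ _ := by
        rw [energyOf_eq_lintegral]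
        exact tsum_mul_measure_Ici_le _ ht hd.le a

end HighEnergy

/-! ### Truncating the energy from below. -/

section EnergyLimits

variable {H : Type*} [NormedAddCommGroup H] [InnerProductSpace ℂ H] [CompleteSpace H]
  (A : H →ₗ.[ℂ] H) {ρ : H →L[ℂ] H}

theorem ne_zero_of_trace_eq_one (hρ : ρ.IsPositive) (hτ : trace ρ = 1) : ρ ≠ 0 := by
  rintro rfl
  simp [trace] at hτ

/-- Pointwise, `(l + n)₊ + min (l₋, n) = l₊ + n`, and the spectral distribution has total mass 1. -/
theorem energyOf_add_energyOf_min (hρ : ρ.IsPositive) (hτ : trace ρ = 1) (n : ℕ) :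
    energyOf A (fun l => ENNReal.ofReal (l - (-n : ℝ))) ρ +
      energyOf A (fun l => min (ENNReal.ofReal (-l)) n) ρ = energyPos A ρ + n := by
  unfold energyPos
  simp only [energyOf_eq_lintegral]
  have hc : (n : ℝ≥0∞) = ∫⁻ _, (n : ℝ≥0∞) ∂(stateDist A ρ) := by
    rw [lintegral_const, stateDist_univ A hρ, hτ, mul_one]
  conv_rhs => rw [hc]
  rw [← lintegral_add_left (by fun_prop), ← lintegral_add_right _ measurable_const]
  refine lintegral_congr fun l => ?_
  rw [← ENNReal.ofReal_natCast, ← ENNReal.ofReal_min]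
  simp only [ENNReal.ofReal, ← ENNReal.coe_add, ENNReal.coe_inj]
  rw [← NNReal.coe_inj]
  have hn : (0 : ℝ) ≤ n := Nat.cast_nonneg n
  simp only [NNReal.coe_add, Real.coe_toNNReal']
  rcases max_cases (l - (-n : ℝ)) 0 with h1 | h1 <;>
  rcases max_cases (min (-l) (n : ℝ)) 0 with h2 | h2 <;> rcases max_cases l 0 with h3 | h3 <;>
  rcases max_cases (n : ℝ) 0 with h4 | h4 <;> rcases min_cases (-l) (n : ℝ) with h5 | h5 <;>
  linarith

theorem energyNeg_le_of_forall (ρ : H →L[ℂ] H) {B : ℝ≥0∞}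
    (h : ∀ n : ℕ, energyOf A (fun l => min (ENNReal.ofReal (-l)) n) ρ ≤ B) :
    energyNeg A ρ ≤ B := by
  unfold energyNeg
  simp only [energyOf_eq_lintegral] at h ⊢
  have h1 : ∀ l : ℝ, ENNReal.ofReal (-l) = ⨆ n : ℕ, min (ENNReal.ofReal (-l)) n := by
    intro l
    rw [← inf_iSup_eq, ENNReal.iSup_natCast, inf_top_eq]
  rw [lintegral_congr h1, lintegral_iSup
    (f := fun (n : ℕ) (l : ℝ) => min (ENNReal.ofReal (-l)) (n : ℝ≥0∞)) (fun n => by fun_prop)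
    (fun m n hmn l => min_le_min le_rfl (by exact_mod_cast hmn))]
  exact iSup_le h

theorem energy_lt_top (hE : energyPos A ρ ≠ ⊤) : energy A ρ < ⊤ := by
  unfold energy
  lift energyPos A ρ to NNReal using hE with p
  generalize energyNeg A ρ = q
  induction q with
  | top => simp
  | coe q =>
    rw [EReal.coe_nnreal_eq_coe_real, EReal.coe_nnreal_eq_coe_real, ← EReal.coe_sub]
    exact EReal.coe_lt_top _

end EnergyLimits

/-! ### From the core estimate to the parametric inequalities. -/

section Conclusion

variable {X : Type*} [MeasurableSpace X] {μ : Measure X}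
  {V : Type*} [NormedAddCommGroup V] [InnerProductSpace ℂ V] [CompleteSpace V]
  {ρ : Lp V 2 μ →L[ℂ] Lp V 2 μ} (A : Lp V 2 μ →ₗ.[ℂ] Lp V 2 μ)

theorem specDensity_le_of_negLegendre_le {t c : ℝ}
    (h : negLegendre (fun l => ENNReal.log (specDensity A l)) t ≤ c) (l : ℝ) :
    specDensity A l ≤ ENNReal.ofReal (Real.exp (c + t * l)) := by
  have h1 := EReal.exp_monotone (le_add_of_negLegendre_le h l)
  rwa [ENNReal.exp_log, EReal.exp_coe] at h1

variable [SigmaFinite μ]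

theorem ae_log_eq_logDens (hρ : ρ.IsPositive) (hτ : trace ρ ≠ ⊤) (hρ0 : ρ ≠ 0) :
    ∀ᵐ x ∂(densMeasure ρ), ENNReal.log (dens ρ x / ‖ρ‖ₑ) = (logDens ρ x : EReal) := by
  rw [← withDensity_dens ρ, ae_withDensity_iff (measurable_dens ρ)]
  filter_upwards [ae_dens_ne_top hρ hτ] with x hx h0
  exact ENNReal.log_pos_real (ENNReal.div_ne_zero.2 ⟨h0, enorm_ne_top⟩)
    (ENNReal.div_ne_top hx (by simpa using hρ0))

theorem logDensPos_eq (hρ : ρ.IsPositive) (hτ : trace ρ ≠ ⊤) (hρ0 : ρ ≠ 0) :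
    logDensPos ρ = ∫⁻ x, ENNReal.ofReal (logDens ρ x) ∂(densMeasure ρ) := by
  refine lintegral_congr_ae ?_
  filter_upwards [ae_log_eq_logDens hρ hτ hρ0] with x hx
  rw [hx, EReal.real_coe_toENNReal]

theorem logDensNeg_eq (hρ : ρ.IsPositive) (hτ : trace ρ ≠ ⊤) (hρ0 : ρ ≠ 0) :
    logDensNeg ρ = ∫⁻ x, ENNReal.ofReal (-logDens ρ x) ∂(densMeasure ρ) := by
  refine lintegral_congr_ae ?_
  filter_upwards [ae_log_eq_logDens hρ hτ hρ0] with x hx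
  rw [hx, ← EReal.coe_neg, EReal.real_coe_toENNReal]

theorem logDensPos_le (hρ : ρ.IsPositive) (hτ : trace ρ = 1) (k : ℝ) :
    logDensPos ρ ≤
      ∫⁻ x, ENNReal.ofReal (logDens ρ x - k) ∂(densMeasure ρ) + ENNReal.ofReal k := by
  have hm := measurable_logDens ρ
  rw [logDensPos_eq hρ (by simp [hτ]) (ne_zero_of_trace_eq_one hρ hτ)]
  calc ∫⁻ x, ENNReal.ofReal (logDens ρ x) ∂(densMeasure ρ)
      ≤ ∫⁻ x, (ENNReal.ofReal (logDens ρ x - k) + ENNReal.ofReal k) ∂(densMeasure ρ) := by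
        refine lintegral_mono fun x => ?_
        refine le_trans (ENNReal.ofReal_le_ofReal ?_) ENNReal.ofReal_add_le
        linarith
    _ = _ := by
        rw [lintegral_add_right _ measurable_const, lintegral_const, densMeasure_univ hρ, hτ,
          mul_one]

/-- The integrated form of `L - k ≤ (L - k)₊`, written without subtraction so that it makes sense in
`[0, ∞]`. -/
theorem logDensPos_add_le (hρ : ρ.IsPositive) (hτ : trace ρ = 1) (k : ℝ) :
    logDensPos ρ + ENNReal.ofReal (-k) ≤ logDensNeg ρ +
      ∫⁻ x, ENNReal.ofReal (logDens ρ x - k) ∂(densMeasure ρ) + ENNReal.ofReal k := by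
  have hm := measurable_logDens ρ
  have hρ0 := ne_zero_of_trace_eq_one hρ hτ
  have hν : densMeasure ρ Set.univ = 1 := by rw [densMeasure_univ hρ, hτ]
  have hc : ∀ c : ℝ≥0∞, c = ∫⁻ _, c ∂(densMeasure ρ) := fun c => by
    rw [lintegral_const, hν, mul_one]
  rw [logDensPos_eq hρ (by simp [hτ]) hρ0, logDensNeg_eq hρ (by simp [hτ]) hρ0]
  conv_lhs => rw [hc (ENNReal.ofReal (-k))]
  conv_rhs => rw [hc (ENNReal.ofReal k)]
  rw [← lintegral_add_right _ measurable_const, ← lintegral_add_right _ (by fun_prop),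
    ← lintegral_add_right _ measurable_const]
  refine lintegral_mono fun x => ?_
  simp only [ENNReal.ofReal, ← ENNReal.coe_add, ENNReal.coe_le_coe]
  rw [← NNReal.coe_le_coe]
  simp only [NNReal.coe_add, Real.coe_toNNReal']
  rcases max_cases (logDens ρ x) 0 with h1 | h1 <;> rcases max_cases (-k) 0 with h2 | h2 <;>
  rcases max_cases (-logDens ρ x) 0 with h3 | h3 <;>
  rcases max_cases (logDens ρ x - k) 0 with h4 | h4 <;>
  rcases max_cases k 0 with h5 | h5 <;> linarith

theorem neg_spatialEntropy_le (hρ : ρ.IsPositive) (hτ : trace ρ = 1) {k : ℝ} {T : ℝ≥0∞}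
    (hT : T ≠ ⊤) (h : ∫⁻ x, ENNReal.ofReal (logDens ρ x - k) ∂(densMeasure ρ) ≤ T) :
    -spatialEntropy ρ ≤ ((k - 3 + T.toReal : ℝ) : EReal) := by
  have hP : logDensPos ρ ≠ ⊤ := ne_top_of_le_ne_top
    (ENNReal.add_ne_top.2 ⟨ne_top_of_le_ne_top hT h, ENNReal.ofReal_ne_top⟩)
    (logDensPos_le hρ hτ k)
  have hle := (logDensPos_add_le hρ hτ k).trans (add_le_add_left (add_le_add_right h _) _)
  unfold spatialEntropy
  rw [hτ]
  generalize logDensPos ρ = P at hP hle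
  generalize logDensNeg ρ = N at hle
  lift P to NNReal using hP
  lift T to NNReal using hT
  -- If the negative part has infinite integral, the entropy is `+∞` and the bound is trivial.
  rcases eq_or_ne N ⊤ with rfl | hN
  · have : (3 : EReal) * ((1 : ℝ≥0∞) : EReal) = ((3 : ℝ) : EReal) := by simp; rfl
    rw [this]
    simp [EReal.coe_nnreal_eq_coe_real]
  · lift N to NNReal using hN
    simp only [ENNReal.ofReal, ← ENNReal.coe_add, ENNReal.coe_le_coe] at hle
    rw [← NNReal.coe_le_coe] at hle
    simp only [NNReal.coe_add, Real.coe_toNNReal'] at hle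
    have : (3 : EReal) * ((1 : ℝ≥0∞) : EReal) = ((3 : ℝ) : EReal) := by simp; rfl
    rw [this, EReal.coe_nnreal_eq_coe_real, EReal.coe_nnreal_eq_coe_real, ← EReal.coe_sub,
      ← EReal.coe_add, ← EReal.coe_neg, EReal.coe_le_coe_iff, ENNReal.coe_toReal]
    rcases max_cases k 0 with h2 | h2 <;> rcases max_cases (-k) 0 with h3 | h3 <;> linarith

theorem logDensPos_ne_top_of_specDensity_le (hρ : ρ.IsPositive) (hτ : trace ρ = 1)
    (hE : energyPos A ρ ≠ ⊤) {t c : ℝ} (ht : 0 < t)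
    (hF : ∀ l, 0 ≤ l → specDensity A l ≤ ENNReal.ofReal (Real.exp (c + t * l))) :
    logDensPos ρ ≠ ⊤ := by
  have h := lintegral_logDens_sub_le A hρ (by simp [hτ]) (ne_zero_of_trace_eq_one hρ hτ) (a := 0)
    ht one_pos (by simpa using hF)
  simp only [sub_zero, sub_sub] at h
  refine ne_top_of_le_ne_top (ENNReal.add_ne_top.2 ⟨ne_top_of_le_ne_top
    (ENNReal.mul_ne_top ENNReal.ofReal_ne_top ?_) h, ENNReal.ofReal_ne_top⟩)
    (logDensPos_le hρ hτ _)
  exact hE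

/-- The entropy bound with the energy counted from the level `a` upwards. -/
theorem neg_spatialEntropy_le_energyOf (hρ : ρ.IsPositive) (hτ : trace ρ = 1) {t a c : ℝ}
    (ht : 0 < t)
    (hF : ∀ l, a ≤ l → specDensity A l ≤ ENNReal.ofReal (Real.exp (c + t * (l - a))))
    (hT : energyOf A (fun l => ENNReal.ofReal (l - a)) ρ ≠ ⊤) :
    -spatialEntropy ρ ≤
      ((c + t * (energyOf A (fun l => ENNReal.ofReal (l - a)) ρ).toReal : ℝ) : EReal) := by
  refine EReal.le_of_forall_lt_iff_le.1 fun z hz => ?_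
  rw [EReal.coe_lt_coe_iff] at hz
  -- The mesh `d` is the gap between `z` and the claimed bound; the 3 cancels against `3 τ(ρ)`.
  have h := lintegral_logDens_sub_le A hρ (by simp [hτ]) (ne_zero_of_trace_eq_one hρ hτ)
    ht (sub_pos.2 hz) hF
  simp only [sub_sub] at h
  refine (neg_spatialEntropy_le hρ hτ (ENNReal.mul_ne_top ENNReal.ofReal_ne_top hT) h).trans ?_
  rw [EReal.coe_le_coe_iff, ENNReal.toReal_mul, ENNReal.toReal_ofReal ht.le]
  linarith

/-- The parametric inequality for positive `t`. -/
theorem neg_spatialEntropy_le_of_pos (hρ : ρ.IsPositive) (hτ : trace ρ = 1)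
    (hE : energyPos A ρ ≠ ⊤) {t c : ℝ} (ht : 0 < t)
    (hF : ∀ l, specDensity A l ≤ ENNReal.ofReal (Real.exp (c + t * l))) :
    -spatialEntropy ρ ≤ c + (t : EReal) * energy A ρ := by
  have key : ∀ n : ℕ, -spatialEntropy ρ ≤ ((c + t * ((energyPos A ρ).toReal -
      (energyOf A (fun l => min (ENNReal.ofReal (-l)) n) ρ).toReal) : ℝ) : EReal) := by
    intro n
    have h1 := energyOf_add_energyOf_min A hρ hτ n
    have h2 : energyPos A ρ + n ≠ ⊤ := ENNReal.add_ne_top.2 ⟨hE, ENNReal.natCast_ne_top n⟩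
    have h3 := ENNReal.add_ne_top.1 (h1.trans_ne h2)
    have h4 := congrArg ENNReal.toReal h1
    rw [ENNReal.toReal_add h3.1 h3.2, ENNReal.toReal_add hE (ENNReal.natCast_ne_top n),
      ENNReal.toReal_natCast] at h4
    -- The line `c + t l` re-centred at `-n`; the term `-t n` then cancels the `n` gained by the
    -- energy above `-n`.
    refine (neg_spatialEntropy_le_energyOf A hρ hτ (a := -n) (c := c - t * n) ht
      (fun l _ => (hF l).trans_eq (by congr 2; ring)) h3.1).trans_eq ?_
    congr 1
    rw [← eq_sub_iff_add_eq] at h4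
    rw [h4]
    ring
  have hMtop : ∀ n : ℕ, energyOf A (fun l => min (ENNReal.ofReal (-l)) n) ρ ≠ ⊤ := fun n =>
    (ENNReal.add_ne_top.1 ((energyOf_add_energyOf_min A hρ hτ n).trans_ne
      (ENNReal.add_ne_top.2 ⟨hE, ENNReal.natCast_ne_top n⟩))).2
  generalize -spatialEntropy ρ = s at key
  induction s with
  | bot => exact bot_le
  | top => exact absurd (top_le_iff.1 (key 0)) (EReal.coe_ne_top _)
  | coe s =>
    simp only [EReal.coe_le_coe_iff] at key
    -- `key` solved for the truncated negative energy: a bound uniform in `n`, hence finiteness of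
    -- `energyNeg A ρ` when the left side is real.
    set B := (energyPos A ρ).toReal - (s - c) / t with hB
    have hM : ∀ n : ℕ, (energyOf A (fun l => min (ENNReal.ofReal (-l)) n) ρ).toReal ≤ B := by
      intro n
      have h1 : (s - c) / t ≤ (energyPos A ρ).toReal -
          (energyOf A (fun l => min (ENNReal.ofReal (-l)) n) ρ).toReal := by
        rw [div_le_iff₀' ht]
        linarith [key n]
      linarith
    have hneg : energyNeg A ρ ≤ ENNReal.ofReal B := energyNeg_le_of_forall A ρ fun n =>
      ENNReal.le_ofReal_iff_toReal_le (hMtop n) (ENNReal.toReal_nonneg.trans (hM n)) |>.2 (hM n)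
    have hneg2 : energyNeg A ρ ≠ ⊤ := ne_top_of_le_ne_top ENNReal.ofReal_ne_top hneg
    have hneg3 : (energyNeg A ρ).toReal ≤ B :=
      ENNReal.toReal_le_of_le_ofReal (ENNReal.toReal_nonneg.trans (hM 0)) hneg
    have he : energy A ρ = (((energyPos A ρ).toReal - (energyNeg A ρ).toReal : ℝ) : EReal) := by
      rw [energy, EReal.coe_sub, EReal.coe_ennreal_toReal hE, EReal.coe_ennreal_toReal hneg2]
    rw [he, ← EReal.coe_mul, ← EReal.coe_add, EReal.coe_le_coe_iff]
    have h5 : (s - c) / t ≤ (energyPos A ρ).toReal - (energyNeg A ρ).toReal := by linarith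
    rw [div_le_iff₀' ht] at h5
    linarith

/-- The parametric inequality at `t = 0`. -/
theorem neg_spatialEntropy_le_of_bounded (hρ : ρ.IsPositive) (hτ : trace ρ = 1)
    (hE : energyPos A ρ ≠ ⊤) {c : ℝ}
    (hF : ∀ l, specDensity A l ≤ ENNReal.ofReal (Real.exp c)) :
    -spatialEntropy ρ ≤ c := by
  refine EReal.le_of_forall_lt_iff_le.1 fun z hz => ?_
  rw [EReal.coe_lt_coe_iff] at hz
  have hP : 0 ≤ (energyPos A ρ).toReal := ENNReal.toReal_nonneg
  -- A slope so small that the energy term costs at most `z - c`; the `+ 1` covers zero positive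
  -- energy.
  have ht : 0 < (z - c) / ((energyPos A ρ).toReal + 1) := div_pos (by linarith) (by linarith)
  have he : energyOf A (fun l => ENNReal.ofReal (l - 0)) ρ = energyPos A ρ := by
    simp [energyPos]
  refine (neg_spatialEntropy_le_energyOf A hρ hτ (a := 0) (c := c) ht (fun l hl => ?_)
    (he ▸ hE)).trans ?_
  · refine (hF l).trans (ENNReal.ofReal_le_ofReal (Real.exp_le_exp.2 ?_))
    have := mul_nonneg ht.le hl
    simpa using this
  · rw [he, EReal.coe_le_coe_iff]
    have : (z - c) / ((energyPos A ρ).toReal + 1) * (energyPos A ρ).toReal ≤ z - c := by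
      rw [div_mul_eq_mul_div, div_le_iff₀ (by linarith)]
      nlinarith
    linarith

theorem monotone_log_specDensity : Monotone fun l => ENNReal.log (specDensity A l) :=
  ENNReal.log_monotone.comp (specDensity_mono A)

/-- A vanishing `F_A` is below `exp c` for every real `c`, so the slope-zero bound holds with `c`
arbitrarily negative. -/
theorem neg_spatialEntropy_le_of_eq_bot (hρ : ρ.IsPositive) (hτ : trace ρ = 1)
    (hE : energyPos A ρ ≠ ⊤) (h : ∀ l, ENNReal.log (specDensity A l) = ⊥) :
    -spatialEntropy ρ ≤ ⊥ := by
  refine EReal.le_of_forall_lt_iff_le.1 fun z _ => neg_spatialEntropy_le_of_bounded A hρ hτ hE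
    fun l => ?_
  simp [ENNReal.log_eq_bot_iff.1 (h l)]

/-- The parametric log-Sobolev inequality. Self-adjointness of `A` only serves to identify
`spectralMeasure A` as the resolution of the identity of `A`; the inequality itself holds for every
projection-valued measure. -/
theorem neg_spatialEntropy_le_negLegendre (hρ : ρ.IsPositive) (hτ : trace ρ = 1)
    (hE : energyPos A ρ ≠ ⊤) {t : ℝ}
    (ht : negLegendre (fun l => ENNReal.log (specDensity A l)) t ≠ ⊤) :
    -spatialEntropy ρ ≤
      negLegendre (fun l => ENNReal.log (specDensity A l)) t + (t : EReal) * energy A ρ := by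
  rcases lt_trichotomy t 0 with h0 | rfl | h0
  · exact (neg_spatialEntropy_le_of_eq_bot A hρ hτ hE
      (eq_bot_of_negLegendre_ne_top (monotone_log_specDensity A) h0 ht)).trans bot_le
  · refine le_add_of_forall_real_le ht (by simp) fun c hc => ?_
    have := neg_spatialEntropy_le_of_bounded A hρ hτ hE (c := c) fun l => by
      simpa using specDensity_le_of_negLegendre_le A hc.le l
    simpa using this
  · refine le_add_of_forall_real_le ht ?_ fun c hc =>
      neg_spatialEntropy_le_of_pos A hρ hτ hE h0 (specDensity_le_of_negLegendre_le A hc.le)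
    have he := energy_lt_top A hE
    generalize energy A ρ = e at he
    induction e with
    | top => exact absurd he (lt_irrefl _)
    | bot => simp [EReal.coe_mul_bot_of_pos h0]
    | coe e => rw [← EReal.coe_mul]; exact EReal.coe_ne_top _

theorem logDensPos_ne_top (hρ : ρ.IsPositive) (hτ : trace ρ = 1)
    (hE : energyPos A ρ ≠ ⊤) {t : ℝ}
    (ht : negLegendre (fun l => ENNReal.log (specDensity A l)) t ≠ ⊤) : logDensPos ρ ≠ ⊤ := by
  obtain ⟨c, hc, -⟩ := EReal.lt_iff_exists_real_btwn.1 (lt_top_iff_ne_top.2 ht)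
  -- Raising the slope keeps the majorant on `l ≥ 0`, the only range needed when energy is counted
  -- from 0.
  have ht' : 0 < max t 1 := one_pos.trans_le (le_max_right _ _)
  refine logDensPos_ne_top_of_specDensity_le A hρ hτ hE ht' (c := c) fun l hl => ?_
  refine (specDensity_le_of_negLegendre_le A hc.le l).trans ?_
  gcongr
  exact le_max_left _ _

end Conclusion

end EntropyEnergy

end

theorem mainTheorem6 {X : Type*} [MeasurableSpace X] (μ : Measure X) [SigmaFinite μ]
    {V : Type*} [NormedAddCommGroup V] [InnerProductSpace ℂ V] [CompleteSpace V]
    [TopologicalSpace.SeparableSpace V]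
    (A : Lp V 2 μ →ₗ.[ℂ] Lp V 2 μ) (hA : IsSelfAdjoint A)
    (ρ : Lp V 2 μ →L[ℂ] Lp V 2 μ) (hρ : ρ.IsPositive)
    (hτ : EntropyEnergy.trace ρ = 1) (hE : EntropyEnergy.energyPos A ρ < ⊤) :
    -- the entropy-energy inequality
    -EntropyEnergy.spatialEntropy ρ ≤
        EntropyEnergy.extendBot
          (EntropyEnergy.concaveHull fun l => ENNReal.log (EntropyEnergy.specDensity A l))
          (EntropyEnergy.energy A ρ) ∧
    -- the integral defining the spatial entropy makes sense when the bound is finite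
    (EntropyEnergy.extendBot
          (EntropyEnergy.concaveHull fun l => ENNReal.log (EntropyEnergy.specDensity A l))
          (EntropyEnergy.energy A ρ) < ⊤ → EntropyEnergy.logDensPos ρ < ⊤) ∧
    -- the parametric log-Sobolev inequalities
    (∀ t : ℝ,
      EntropyEnergy.negLegendre
          (fun l => ENNReal.log (EntropyEnergy.specDensity A l)) t ≠ ⊤ →
      -EntropyEnergy.spatialEntropy ρ ≤
        EntropyEnergy.negLegendre
            (fun l => ENNReal.log (EntropyEnergy.specDensity A l)) t
          * (EntropyEnergy.trace ρ : EReal)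
        + (t : EReal) * EntropyEnergy.energy A ρ) ∧
    -- the two forms carry the same bound
    (∀ s e : EReal, e < ⊤ →
      (s ≤ EntropyEnergy.extendBot
          (EntropyEnergy.concaveHull fun l => ENNReal.log (EntropyEnergy.specDensity A l)) e ↔
        ∀ t : ℝ,
          EntropyEnergy.negLegendre
              (fun l => ENNReal.log (EntropyEnergy.specDensity A l)) t ≠ ⊤ →
          s ≤ EntropyEnergy.negLegendre
              (fun l => ENNReal.log (EntropyEnergy.specDensity A l)) t + (t : EReal) * e)) := by
  have hE' : EntropyEnergy.energyPos A ρ ≠ ⊤ := hE.ne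
  have hmono := EntropyEnergy.monotone_log_specDensity A
  refine ⟨?_, fun h => ?_, fun t ht => ?_, fun s e he =>
    EntropyEnergy.le_extendBot_concaveHull_iff hmono s he⟩
  · rw [EntropyEnergy.le_extendBot_concaveHull_iff hmono _ (EntropyEnergy.energy_lt_top A hE')]
    exact fun t ht => EntropyEnergy.neg_spatialEntropy_le_negLegendre A hρ hτ hE' ht
  · obtain ⟨t, ht⟩ := EntropyEnergy.exists_negLegendre_ne_top h
    exact lt_top_iff_ne_top.2 (EntropyEnergy.logDensPos_ne_top A hρ hτ hE' ht)
  · rw [hτ, EReal.coe_ennreal_one, mul_one]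
    exact EntropyEnergy.neg_spatialEntropy_le_negLegendre A hρ hτ hE' ht
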